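/- Let $d\ge 2$, let $1\le p,q\le\infty$, and let $z\in\mathbb C\setminus[0,\infty)$. For a Schwartz function $f\in\mathcal S(\mathbb R^d)$ (complex valued) let $(-\Delta-z)^{-1}f=\mathcal F^{-1}\big((|\xi|^2-z)^{-1}\,\mathcal F f(\xi)\big)$, where $\mathcal F f(\xi)=\int_{\mathbb R^d} f(x)e^{-ix\cdot\xi}\,dx$, and let \[ \|(-\Delta-z)^{-1}\|_{p\to q}:=\inf\big\{C\ge 0:\ \|(-\Delta-z)^{-1}f\|_{L^q(\mathbb R^d)}\le C\|f\|_{L^p(\mathbb R^d)}\ \text{ for all } f\in\mathcal S(\mathbb R^d)\big\} \] (with $\inf\emptyset=\infty$). Then $\|(-\Delta-z)^{-1}\|_{p\to q}<\infty$ if and only if $(1/p,1/q)\in\mathcal R_0(d)$, where $1/\infty=0$ and \[ \mathcal R_0(d)=\begin{cases} \{(x,y): 0\le x,y\le 1,\ 0\le x-y<1\} & \text{if } d=2,\\[4pt] \{(x,y): 0\le x,y\le 1,\ 0\le x-y\le \tfrac2d\}\setminus\{(1,\tfrac{d-2}{d}),(\tfrac2d,0)\} & \text{if } d\ge 3. \end{cases}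 \] -/

import Mathlib

open MeasureTheory
open scoped ENNReal SchwartzMap FourierTransform

noncomputable section

/-- The resolvent of the Laplacian on `ℝᵈ` applied to a Schwartz function, i.e. the Fourier
multiplier operator with symbol `(|ξ|² - z)⁻¹`. The Fourier transform here is normalised
as `𝓕 f ξ = ∫ f(x) exp(-2πi x·ξ) dx`, in which `-Δ` has symbol `(2π|ξ|)²`.
For `z ∉ [0,∞)` the denominator never vanishes. -/
def laplaceResolvent (d : ℕ) (z : ℂ) (f : 𝓢(EuclideanSpace ℝ (Fin d), ℂ)) :
    EuclideanSpace ℝ (Fin d) → ℂ :=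
  𝓕⁻ (fun ξ : EuclideanSpace ℝ (Fin d) =>
    ((((2 * Real.pi * ‖ξ‖) ^ 2 : ℝ) : ℂ) - z)⁻¹ * 𝓕 (f : EuclideanSpace ℝ (Fin d) → ℂ) ξ)

/-- The norm `‖(-Δ - z)⁻¹‖_{p → q}`: the infimum of all constants `C` such that
`‖(-Δ - z)⁻¹ f‖_q ≤ C ‖f‖_p` for every Schwartz function `f`.
It is `∞` exactly when no finite constant is admissible. -/
def resolventNorm (d : ℕ) (z : ℂ) (p q : ℝ≥0∞) : ℝ≥0∞ :=
  sInf {C : ℝ≥0∞ | ∀ f : 𝓢(EuclideanSpace ℝ (Fin d), ℂ),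
    eLpNorm (laplaceResolvent d z f) q volume ≤ C * eLpNorm f p volume}

/-- The region `R₀(d)` of the `(1/p, 1/q)`-plane, for `d ≥ 2`. -/
def regionR0 (d : ℕ) : Set (ℝ × ℝ) :=
  if d = 2 then
    {v | 0 ≤ v.1 ∧ v.1 ≤ 1 ∧ 0 ≤ v.2 ∧ v.2 ≤ 1 ∧ 0 ≤ v.1 - v.2 ∧ v.1 - v.2 < 1}
  else
    {v | 0 ≤ v.1 ∧ v.1 ≤ 1 ∧ 0 ≤ v.2 ∧ v.2 ≤ 1 ∧ 0 ≤ v.1 - v.2 ∧ v.1 - v.2 ≤ 2 / (d : ℝ)} \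
      {(1, ((d : ℝ) - 2) / (d : ℝ)), (2 / (d : ℝ), 0)}

end

/-!
Everything rests on writing the resolvent as an integral of heat kernels. For `z ∉ [0, ∞)` there is
a direction `w` with `re w > 0` and `re (-w z) > 0`, and integrating `e^{-t w (|2πξ|² - z)}` along
the ray `t w` instead of `t` yields
`(-Δ - z)⁻¹ = w ∫₀^∞ e^{t w z} e^{t w Δ} dt` (`laplaceResolvent_eq_integral_heat`). Taking absolute
values in the complex Gaussian kernels bounds the resolvent by convolution with
`K(x) = ∫₀^∞ e^{-ct} t^{-d/2} e^{-a|x|²/t} dt` (`exists_enorm_laplaceResolvent_le`).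

Sufficiency. Below the Sobolev line `1/p - 1/q = 2/d` the kernel `K` is in the `L^r` required by
Young's inequality (`lintegral_resolventMajorant_rpow_lt_top`, `lintegral_conv_rpow_le`). On the
line, with `1 < p` and `q < ∞`, the Hardy–Littlewood–Sobolev inequality is proved directly. To
estimate the measure of `{K * f > s}` the kernel is split at the heat time `T = s^{-2q/d}` and `f`
at the height `s / T`, so that only the early-time part applied to the large values of `f` matters;
Chebyshev's inequality and integration in `s` give the strong-type bound at once
(`meas_lt_conv_le`, `exists_lintegral_conv_rpow_le`), without interpolation.

Necessity. Dilations turn a bound at `z` into bounds at `r⁻² z`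
(`eLpNorm_laplaceResolvent_rescaled`). As `r → 0` the operators converge to the scalar `-z⁻¹`, which
forces `1/q ≤ 1/p`. As `r → ∞` and for `d ≥ 3` they converge to `(-Δ)⁻¹`; this excludes
`1/p - 1/q > 2/d` and leaves on the Sobolev line an `L^p → L^q` bound for `(-Δ)⁻¹`. There the heat
kernel representation has positive kernels and bounds `(-Δ)⁻¹` below by convolution with
`(1 + |x|²)^{1-d/2}` (`exists_le_enorm_laplaceResolvent_zero`), and both endpoints fail because
`∫ (1 + |x|²)^{-d/2} dx` diverges. For `d = 2` only `L¹ → L^∞` remains, which fails because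
`∫ |ξ|⁻² dξ` diverges at the origin.
-/

noncomputable section

variable {d : ℕ}

/-! ### The resolvent as an integral of the heat semigroup -/

/-- The symbol `|2πξ|² - z` of `-Δ - z` for the Fourier transform with kernel `e^{-2πi x·ξ}`. -/
def laplaceSymbol (d : ℕ) (z : ℂ) (ξ : EuclideanSpace ℝ (Fin d)) : ℂ :=
  (((2 * Real.pi * ‖ξ‖) ^ 2 : ℝ) : ℂ) - z

/-- The heat kernel `(4πs)^{-d/2} e^{-|x|²/(4s)}` at complex time `s`, used for `0 < re s`. -/
def complexHeatKernel (d : ℕ) (s : ℂ) (x : EuclideanSpace ℝ (Fin d)) : ℂ :=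
  (1 / (4 * Real.pi * s)) ^ (((d : ℝ) / 2 : ℝ) : ℂ) * Complex.exp (-(‖x‖ : ℂ) ^ 2 / (4 * s))

lemma continuous_laplaceSymbol (z : ℂ) : Continuous (laplaceSymbol d z) := by
  unfold laplaceSymbol; fun_prop

lemma laplaceResolvent_apply (z : ℂ) (f : 𝓢(EuclideanSpace ℝ (Fin d), ℂ))
    (x : EuclideanSpace ℝ (Fin d)) :
    laplaceResolvent d z f x = ∫ ξ, Complex.exp (2 * Real.pi * Complex.I * (inner ℝ x ξ : ℝ)) *
      ((laplaceSymbol d z ξ)⁻¹ * 𝓕 f ξ) := by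
  rw [laplaceResolvent, Real.fourierInv_eq']
  refine integral_congr_ae (Filter.Eventually.of_forall fun ξ => ?_)
  simp only [laplaceSymbol, smul_eq_mul, SchwartzMap.fourier_coe, real_inner_comm x ξ]
  congr 2
  push_cast; ring

/-- The heat semigroup at complex time `s`, written on the Fourier side and in physical space. -/
lemma integral_exp_mul_fourier_eq {s : ℂ} (hs : 0 < s.re) (f : 𝓢(EuclideanSpace ℝ (Fin d), ℂ))
    (x : EuclideanSpace ℝ (Fin d)) :
    ∫ ξ, Complex.exp (-s * (((2 * Real.pi * ‖ξ‖) ^ 2 : ℝ) : ℂ) +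
      2 * Real.pi * Complex.I * (inner ℝ x ξ : ℝ)) * 𝓕 f ξ =
      ∫ y, complexHeatKernel d s (x - y) * f y := by
  have hs0 : s ≠ 0 := by rintro rfl; simp at hs
  have hπ : (Real.pi : ℂ) ≠ 0 := by exact_mod_cast Real.pi_ne_zero
  set b : ℂ := 4 * Real.pi ^ 2 * s with hb_def
  have hb : 0 < b.re := by
    have : b = ((4 * Real.pi ^ 2 : ℝ) : ℂ) * s := by rw [hb_def]; push_cast; ring
    rw [this, Complex.re_ofReal_mul]; positivity
  have hg := GaussianFourier.integrable_cexp_neg_mul_sq_norm_add hb (2 * Real.pi * Complex.I) x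
  have h := VectorFourier.integral_fourierIntegral_smul_eq_flip
    (L := innerₗ (EuclideanSpace ℝ (Fin d))) (μ := volume) (ν := volume)
    Real.continuous_fourierChar continuous_inner f.integrable hg
  calc _ = ∫ ξ, 𝓕 (f : EuclideanSpace ℝ (Fin d) → ℂ) ξ *
        Complex.exp (-b * ‖ξ‖ ^ 2 + 2 * Real.pi * Complex.I * (inner ℝ x ξ : ℝ)) := by
        refine integral_congr_ae (Filter.Eventually.of_forall fun ξ => ?_)
        simp only [SchwartzMap.fourier_coe]
        rw [mul_comm]; congr 3
        rw [hb_def]; push_cast; ring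
    _ = ∫ y, f y * 𝓕 (fun ξ : EuclideanSpace ℝ (Fin d) =>
        Complex.exp (-b * ‖ξ‖ ^ 2 + 2 * Real.pi * Complex.I * (inner ℝ x ξ : ℝ))) y := by
        rw [flip_innerₗ] at h
        exact h
    _ = _ := by
        refine integral_congr_ae (Filter.Eventually.of_forall fun y => ?_)
        simp only
        rw [fourier_gaussian_innerProductSpace' hb x y, mul_comm, complexHeatKernel]
        congr 2
        · congr 1
          · rw [hb_def]; field_simp
          · simp
        · congr 1
          rw [hb_def]; field_simp

/-- Subordination of the resolvent to the heat semigroup along the ray `t ↦ t w`, from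
`m⁻¹ = w ∫₀^∞ e^{-t w m} dt` whenever `0 < re (w m)`. Rotating the ray by the right `w` reaches
every `z ∉ [0, ∞)`; `z = 0` is also covered, in those dimensions where the integrability holds. -/
lemma laplaceResolvent_eq_integral_heat {w z : ℂ} (hw : 0 < w.re)
    (f : 𝓢(EuclideanSpace ℝ (Fin d), ℂ))
    (hm : ∀ᵐ ξ : EuclideanSpace ℝ (Fin d), 0 < (w * laplaceSymbol d z ξ).re)
    (hint : Integrable fun ξ : EuclideanSpace ℝ (Fin d) =>
      (w * laplaceSymbol d z ξ).re⁻¹ * ‖𝓕 f ξ‖)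
    (x : EuclideanSpace ℝ (Fin d)) :
    IntegrableOn (fun t : ℝ => Complex.exp (t * w * z) *
      ∫ y, complexHeatKernel d (t * w) (x - y) * f y) (Set.Ioi 0) ∧
    laplaceResolvent d z f x = w * ∫ t in Set.Ioi (0 : ℝ), Complex.exp (t * w * z) *
      ∫ y, complexHeatKernel d (t * w) (x - y) * f y := by
  set A : ℝ × EuclideanSpace ℝ (Fin d) → ℂ := fun p =>
    Complex.exp (-(w * laplaceSymbol d z p.2) * p.1) *
      (Complex.exp (2 * Real.pi * Complex.I * (inner ℝ x p.2 : ℝ)) * 𝓕 f p.2) with hA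
  have hAc : Continuous A := by
    have h1 := continuous_laplaceSymbol (d := d) z
    have h2 := (𝓕 f).continuous
    rw [hA]; fun_prop
  have hnorm : ∀ t ξ, ‖A (t, ξ)‖ = Real.exp (-(w * laplaceSymbol d z ξ).re * t) * ‖𝓕 f ξ‖ := by
    intro t ξ
    simp only [hA, norm_mul, Complex.norm_exp]
    have e1 : (-(w * laplaceSymbol d z ξ) * (t : ℂ)).re = -(w * laplaceSymbol d z ξ).re * t := by
      rw [Complex.re_mul_ofReal, Complex.neg_re]
    have e2 : (2 * Real.pi * Complex.I * (inner ℝ x ξ : ℝ) : ℂ).re = 0 := by simp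
    rw [e1, e2]; simp
  have hAint : Integrable A ((volume.restrict (Set.Ioi 0)).prod volume) := by
    rw [integrable_prod_iff' hAc.aestronglyMeasurable]
    constructor
    · filter_upwards [hm] with ξ hξ
      exact (integrableOn_exp_mul_complex_Ioi (a := -(w * laplaceSymbol d z ξ))
        (by rw [Complex.neg_re]; linarith) 0).integrable.mul_const
          (Complex.exp (2 * Real.pi * Complex.I * (inner ℝ x ξ : ℝ)) * 𝓕 f ξ)
    · refine hint.congr ?_
      filter_upwards [hm] with ξ hξ
      simp_rw [hnorm]
      rw [integral_mul_const, integral_exp_mul_Ioi (by linarith)]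
      rw [mul_zero, Real.exp_zero, neg_div_neg_eq, one_div]
  have hinner : ∀ t ∈ Set.Ioi (0 : ℝ), ∫ ξ, A (t, ξ) = Complex.exp (t * w * z) *
      ∫ y, complexHeatKernel d (t * w) (x - y) * f y := by
    intro t ht
    rw [← integral_exp_mul_fourier_eq (s := t * w)
      (by rw [Complex.re_ofReal_mul]; exact mul_pos ht hw) f x, ← integral_const_mul]
    refine integral_congr_ae (Filter.Eventually.of_forall fun ξ => ?_)
    simp only [hA, laplaceSymbol, ← mul_assoc, ← Complex.exp_add]
    congr 2
    ring
  refine ⟨hAint.integral_prod_left.congr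
    ((ae_restrict_iff' measurableSet_Ioi).2 (Filter.Eventually.of_forall hinner)), ?_⟩
  rw [← setIntegral_congr_fun measurableSet_Ioi hinner, integral_integral_swap
    (f := fun t ξ => A (t, ξ)) hAint, laplaceResolvent_apply, ← integral_const_mul]
  refine integral_congr_ae ?_
  filter_upwards [hm] with ξ hξ
  have hne : w * laplaceSymbol d z ξ ≠ 0 := by
    intro h; rw [h] at hξ; simp at hξ
  simp only [hA]
  rw [integral_mul_const, integral_exp_mul_complex_Ioi (by simpa using hξ)]
  have hw0 : w ≠ 0 := left_ne_zero_of_mul hne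
  have hl : laplaceSymbol d z ξ ≠ 0 := right_ne_zero_of_mul hne
  simp only [Complex.ofReal_zero, mul_zero, Complex.exp_zero]
  field_simp

/-! ### Pointwise bounds: an explicit majorant, and a lower bound for `(-Δ)⁻¹` -/

/-- The real Gaussian profile `t^{-d/2} e^{-a|x|²/t}`, as an extended nonnegative number. -/
def gaussianProfile (d : ℕ) (a t : ℝ) (x : EuclideanSpace ℝ (Fin d)) : ℝ≥0∞ :=
  ENNReal.ofReal (t ^ (-((d : ℝ) / 2)) * Real.exp (-(a * ‖x‖ ^ 2) / t))

/-- The majorant `∫₀^∞ e^{-ct} t^{-d/2} e^{-a|x|²/t} dt` of the convolution kernel of the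
resolvent. -/
def resolventMajorant (d : ℕ) (a c : ℝ) (x : EuclideanSpace ℝ (Fin d)) : ℝ≥0∞ :=
  ∫⁻ t in Set.Ioi (0 : ℝ), ENNReal.ofReal (Real.exp (-(c * t))) * gaussianProfile d a t x

@[fun_prop]
lemma measurable_gaussianProfile (a : ℝ) :
    Measurable fun p : ℝ × EuclideanSpace ℝ (Fin d) => gaussianProfile d a p.1 p.2 := by
  unfold gaussianProfile; fun_prop

lemma measurable_resolventMajorant (a c : ℝ) : Measurable (resolventMajorant d a c) := by
  unfold resolventMajorant
  refine Measurable.lintegral_prod_left' (f := fun p : ℝ × EuclideanSpace ℝ (Fin d) =>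
    ENNReal.ofReal (Real.exp (-(c * p.1))) * gaussianProfile d a p.1 p.2) ?_
  fun_prop

lemma norm_complexHeatKernel {w : ℂ} (hw : w ≠ 0) {t : ℝ} (ht : 0 < t)
    (x : EuclideanSpace ℝ (Fin d)) :
    ‖complexHeatKernel d (t * w) x‖ = (4 * Real.pi * ‖w‖) ^ (-((d : ℝ) / 2)) *
      (t ^ (-((d : ℝ) / 2)) * Real.exp (-(w.re / (4 * ‖w‖ ^ 2) * ‖x‖ ^ 2) / t)) := by
  have hw' : 0 < ‖w‖ := norm_pos_iff.2 hw
  have hn : ‖(1 / (4 * Real.pi * (t * w)) : ℂ)‖ = ((4 * Real.pi * ‖w‖) * t)⁻¹ := by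
    rw [one_div, norm_inv]
    simp only [norm_mul, Complex.norm_real, Real.norm_eq_abs, abs_of_pos Real.pi_pos,
      abs_of_pos ht, Complex.norm_ofNat]
    ring
  rw [complexHeatKernel, norm_mul, Complex.norm_cpow_real, hn, Complex.norm_exp, Real.inv_rpow
    (by positivity), ← Real.rpow_neg (by positivity), Real.mul_rpow (by positivity) ht.le, mul_assoc]
  congr 3
  have e : (-(‖x‖ : ℂ) ^ 2 / (4 * (t * w))) = ((-(‖x‖ ^ 2) / (4 * t) : ℝ) : ℂ) * w⁻¹ := by
    have ht' : (t : ℂ) ≠ 0 := by exact_mod_cast ht.ne'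
    push_cast; field_simp
  rw [e, Complex.re_ofReal_mul, Complex.inv_re, Complex.normSq_eq_norm_sq]
  field_simp

/-- A direction `w` in the right half plane with `-w z` in the right half plane too:
the conjugate of the principal square root of `-z`. -/
lemma exists_rotation {z : ℂ} (hz : z ∉ (fun t : ℝ => (t : ℂ)) '' Set.Ici 0) :
    ∃ w : ℂ, 0 < w.re ∧ 0 < (-(w * z)).re := by
  have hslit : -z ∈ Complex.slitPlane := by
    rw [Complex.mem_slitPlane_iff]
    by_contra! h
    refine hz ⟨z.re, by simpa using h.1, ?_⟩
    have him : z.im = 0 := by simpa using h.2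
    apply Complex.ext <;> simp [him]
  have h0 : -z ≠ 0 := Complex.slitPlane_ne_zero hslit
  set s : ℂ := (-z) ^ (1 / 2 : ℂ) with hs
  have hs2 : s * s = -z := by
    rw [hs, ← Complex.cpow_add _ _ h0]; norm_num
  have hre : 0 < s.re := by
    rw [hs, Complex.cpow_def_of_ne_zero h0, Complex.exp_re]
    refine mul_pos (Real.exp_pos _) (Real.cos_pos_of_mem_Ioo ?_)
    have h1 : (-z).arg < Real.pi := lt_of_le_of_ne (Complex.arg_le_pi _)
      (Complex.mem_slitPlane_iff_arg.1 hslit).1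
    have h2 := Complex.neg_pi_lt_arg (-z)
    have e : (Complex.log (-z) * (1 / 2)).im = (-z).arg / 2 := by
      rw [show (1 / 2 : ℂ) = ((1 / 2 : ℝ) : ℂ) by push_cast; ring, Complex.im_mul_ofReal,
        Complex.log_im]
      ring
    rw [e]
    constructor <;> linarith
  refine ⟨(starRingEnd ℂ) s, by simpa using hre, ?_⟩
  have e : -((starRingEnd ℂ) s * z) = ((Complex.normSq s : ℝ) : ℂ) * s := by
    rw [Complex.normSq_eq_conj_mul_self, ← mul_neg, ← hs2]; ring
  rw [e, Complex.re_ofReal_mul]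
  exact mul_pos (Complex.normSq_pos.2 (by rintro h; simp [h] at hre)) hre

lemma re_mul_laplaceSymbol (w z : ℂ) (ξ : EuclideanSpace ℝ (Fin d)) :
    (w * laplaceSymbol d z ξ).re = w.re * (2 * Real.pi * ‖ξ‖) ^ 2 + (-(w * z)).re := by
  rw [laplaceSymbol, mul_sub, Complex.sub_re, Complex.re_mul_ofReal, Complex.neg_re]
  ring

/-- The resolvent is dominated pointwise by convolution with an explicit positive kernel. -/
lemma exists_enorm_laplaceResolvent_le {z : ℂ}
    (hz : z ∉ (fun t : ℝ => (t : ℂ)) '' Set.Ici 0) :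
    ∃ a c : ℝ, 0 < a ∧ 0 < c ∧ ∃ C : ℝ≥0∞, C ≠ ∞ ∧
      ∀ (f : 𝓢(EuclideanSpace ℝ (Fin d), ℂ)) (x : EuclideanSpace ℝ (Fin d)),
        ‖laplaceResolvent d z f x‖ₑ ≤ C * ∫⁻ y, resolventMajorant d a c (x - y) * ‖f y‖ₑ := by
  obtain ⟨w, hw, hwz⟩ := exists_rotation hz
  have hw0 : w ≠ 0 := by rintro rfl; simp at hw
  have hw0' : 0 < ‖w‖ := norm_pos_iff.2 hw0
  set a : ℝ := w.re / (4 * ‖w‖ ^ 2) with ha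
  set c : ℝ := (-(w * z)).re with hc
  set B : ℝ≥0∞ := ENNReal.ofReal ((4 * Real.pi * ‖w‖) ^ (-((d : ℝ) / 2))) with hB
  refine ⟨a, c, by positivity, hwz, ‖w‖ₑ * B, ENNReal.mul_ne_top (by simp) (by simp [hB]), ?_⟩
  intro f x
  have hlow : ∀ ξ : EuclideanSpace ℝ (Fin d), c ≤ (w * laplaceSymbol d z ξ).re := by
    intro ξ
    rw [re_mul_laplaceSymbol]
    have : 0 ≤ w.re * (2 * Real.pi * ‖ξ‖) ^ 2 := by positivity
    linarith
  have hcont : Continuous fun ξ : EuclideanSpace ℝ (Fin d) => (w * laplaceSymbol d z ξ).re :=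
    Complex.continuous_re.comp (continuous_const.mul (continuous_laplaceSymbol z))
  have hint : Integrable fun ξ : EuclideanSpace ℝ (Fin d) =>
      (w * laplaceSymbol d z ξ).re⁻¹ * ‖𝓕 f ξ‖ := by
    refine (𝓕 f).integrable.norm.bdd_mul (c := c⁻¹)
      (hcont.inv₀ fun ξ => (hwz.trans_le (hlow ξ)).ne').aestronglyMeasurable
      (Filter.Eventually.of_forall fun ξ => ?_)
    have := hwz.trans_le (hlow ξ)
    rw [Real.norm_eq_abs, abs_of_pos (by positivity)]
    exact inv_anti₀ hwz (hlow ξ)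
  rw [(laplaceResolvent_eq_integral_heat hw f
    (Filter.Eventually.of_forall fun ξ => hwz.trans_le (hlow ξ)) hint x).2, enorm_mul, mul_assoc]
  gcongr
  calc _ ≤ ∫⁻ t in Set.Ioi (0 : ℝ), ‖Complex.exp (t * w * z) *
        ∫ y, complexHeatKernel d (t * w) (x - y) * f y‖ₑ := enorm_integral_le_lintegral_enorm _
    _ ≤ ∫⁻ t in Set.Ioi (0 : ℝ), B * ∫⁻ y, ENNReal.ofReal (Real.exp (-(c * t))) *
        gaussianProfile d a t (x - y) * ‖f y‖ₑ := by
        refine setLIntegral_mono_ae' measurableSet_Ioi (Filter.Eventually.of_forall fun t ht => ?_)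
        have ht : 0 < t := ht
        have e1 : ‖Complex.exp (t * w * z)‖ₑ = ENNReal.ofReal (Real.exp (-(c * t))) := by
          rw [← ofReal_norm, Complex.norm_exp, mul_assoc, Complex.re_ofReal_mul, hc,
            Complex.neg_re]
          congr 2; ring
        rw [enorm_mul, e1]
        simp_rw [mul_assoc]
        rw [lintegral_const_mul' _ _ (by simp), mul_left_comm, ← lintegral_const_mul' _ _ (by simp [hB])]
        gcongr
        refine (enorm_integral_le_lintegral_enorm _).trans (lintegral_mono fun y => ?_)
        rw [enorm_mul, ← mul_assoc]
        gcongr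
        rw [← ofReal_norm, norm_complexHeatKernel hw0 ht,
          ENNReal.ofReal_mul (by positivity)]
        rfl
    _ = B * ∫⁻ y, resolventMajorant d a c (x - y) * ‖f y‖ₑ := by
        rw [lintegral_const_mul' _ _ (by simp [hB])]
        congr 1
        rw [lintegral_lintegral_swap]
        · refine lintegral_congr fun y => ?_
          rw [lintegral_mul_const' _ _ (by simp)]
          rfl
        · have := f.continuous
          refine Measurable.aemeasurable ?_
          unfold Function.uncurry
          have hG : Measurable fun p : ℝ × EuclideanSpace ℝ (Fin d) =>
              gaussianProfile d a p.1 (x - p.2) :=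
            (measurable_gaussianProfile a).comp (f := fun p : ℝ × EuclideanSpace ℝ (Fin d) =>
              (p.1, x - p.2)) (by fun_prop)
          have hf : Measurable f := this.measurable
          exact Measurable.mul (Measurable.mul (by fun_prop) hG) (by fun_prop)

lemma integrableOn_inv_sq_norm (hd : 3 ≤ d) :
    IntegrableOn (fun ξ : EuclideanSpace ℝ (Fin d) => (‖ξ‖ ^ 2)⁻¹) (Metric.ball 0 1) := by
  have : Nonempty (Fin d) := ⟨⟨0, by omega⟩⟩
  rw [integrableOn_fun_norm_addHaar volume (f := fun r : ℝ => (r ^ 2)⁻¹)]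
  have : IntegrableOn (fun y : ℝ => y ^ (d - 3)) (Set.Ioo 0 1) :=
    ((continuous_pow (d - 3)).integrableOn_Icc (a := 0) (b := 1)).mono_set Set.Ioo_subset_Icc_self
  refine this.congr_fun (fun y hy => ?_) measurableSet_Ioo
  have hy0 : y ≠ 0 := hy.1.ne'
  simp only [finrank_euclideanSpace, Fintype.card_fin, smul_eq_mul]
  rw [show d - 1 = (d - 3) + 2 by omega, pow_add]
  field_simp

lemma integrable_inv_sq_norm_mul (hd : 3 ≤ d) (f : 𝓢(EuclideanSpace ℝ (Fin d), ℂ)) :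
    Integrable fun ξ : EuclideanSpace ℝ (Fin d) => (‖ξ‖ ^ 2)⁻¹ * ‖f ξ‖ := by
  obtain ⟨M, -, hM⟩ := f.decay 0 0
  simp only [pow_zero, norm_iteratedFDeriv_zero, one_mul] at hM
  have h1 : Integrable ((Metric.ball (0 : EuclideanSpace ℝ (Fin d)) 1).indicator
      (fun ξ => (‖ξ‖ ^ 2)⁻¹ * M)) :=
    IntegrableOn.integrable_indicator ((integrableOn_inv_sq_norm hd).integrable.mul_const M)
      measurableSet_ball
  refine (h1.add f.integrable.norm).mono' ?_ (Filter.Eventually.of_forall fun ξ => ?_)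
  · have := f.continuous
    exact Measurable.aestronglyMeasurable (by fun_prop)
  · rw [Real.norm_eq_abs, abs_of_nonneg (by positivity)]
    by_cases hξ : ξ ∈ Metric.ball (0 : EuclideanSpace ℝ (Fin d)) 1
    · simp only [Pi.add_apply, Set.indicator_of_mem hξ]
      have := norm_nonneg (f ξ)
      have : (‖ξ‖ ^ 2)⁻¹ * ‖f ξ‖ ≤ (‖ξ‖ ^ 2)⁻¹ * M := by gcongr; exact hM ξ
      linarith
    · simp only [Pi.add_apply, Set.indicator_of_notMem hξ, zero_add]
      have h1 : 1 ≤ ‖ξ‖ := by simpa using hξ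
      have : (‖ξ‖ ^ 2)⁻¹ ≤ 1 := inv_le_one_of_one_le₀ (one_le_pow₀ h1)
      exact mul_le_of_le_one_left (norm_nonneg _) this

lemma complexHeatKernel_ofReal {t : ℝ} (ht : 0 < t) (x : EuclideanSpace ℝ (Fin d)) :
    complexHeatKernel d t x = (((4 * Real.pi * t) ^ (-((d : ℝ) / 2)) *
      Real.exp (-‖x‖ ^ 2 / (4 * t)) : ℝ) : ℂ) := by
  rw [complexHeatKernel, Real.rpow_neg (by positivity), ← Real.inv_rpow (by positivity)]
  push_cast
  rw [Complex.ofReal_cpow (by positivity)]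
  push_cast
  simp

/-- In dimension at least three, `(-Δ)⁻¹` of a nonnegative function is bounded below by a multiple
of its convolution with `(1 + |x|²)^{1 - d/2}`. -/
lemma exists_le_enorm_laplaceResolvent_zero (hd : 3 ≤ d) : ∃ κ : ℝ, 0 < κ ∧
    ∀ (f : 𝓢(EuclideanSpace ℝ (Fin d), ℂ)) (g : EuclideanSpace ℝ (Fin d) → ℝ), (∀ y, 0 ≤ g y) →
      (∀ y, f y = g y) → ∀ x : EuclideanSpace ℝ (Fin d),
      ENNReal.ofReal κ * ∫⁻ y, ENNReal.ofReal ((1 + ‖x - y‖ ^ 2) ^ (1 - (d : ℝ) / 2) * g y) ≤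
        ‖laplaceResolvent d 0 f x‖ₑ := by
  refine ⟨(8 * Real.pi) ^ (-((d : ℝ) / 2)) * Real.exp (-(1 / 4)), by positivity, ?_⟩
  intro f g hg hfg x
  have : Nonempty (Fin d) := ⟨⟨0, by omega⟩⟩
  set k : ℝ → EuclideanSpace ℝ (Fin d) → ℝ := fun t y =>
    (4 * Real.pi * t) ^ (-((d : ℝ) / 2)) * Real.exp (-‖x - y‖ ^ 2 / (4 * t)) * g y with hk
  have hgc : Continuous g := by
    have : g = fun y => (f y).re := by ext y; simp [hfg]
    rw [this]; exact Complex.continuous_re.comp f.continuous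
  have hgi : Integrable g := by
    have : g = fun y => (f y).re := by ext y; simp [hfg]
    rw [this]; exact f.integrable.re
  have hsym : ∀ ξ : EuclideanSpace ℝ (Fin d),
      (1 * laplaceSymbol d 0 ξ).re = (2 * Real.pi * ‖ξ‖) ^ 2 := by
    intro ξ; rw [re_mul_laplaceSymbol]; simp
  have hpos : ∀ᵐ ξ : EuclideanSpace ℝ (Fin d), 0 < (1 * laplaceSymbol d 0 ξ).re := by
    filter_upwards [Measure.ae_ne volume (0 : EuclideanSpace ℝ (Fin d))] with ξ hξ
    rw [hsym]
    have := norm_pos_iff.2 hξ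
    positivity
  have hint : Integrable fun ξ : EuclideanSpace ℝ (Fin d) =>
      (1 * laplaceSymbol d 0 ξ).re⁻¹ * ‖𝓕 f ξ‖ := by
    refine ((integrable_inv_sq_norm_mul hd (𝓕 f)).const_mul ((2 * Real.pi) ^ 2)⁻¹).congr
      (Filter.Eventually.of_forall fun ξ => ?_)
    simp only [hsym]
    rw [mul_pow, mul_inv]; ring
  obtain ⟨hi, heq⟩ := laplaceResolvent_eq_integral_heat (w := 1) (by simp) f hpos hint x
  have hk0 : ∀ t ∈ Set.Ioi (0 : ℝ), ∀ y, 0 ≤ k t y := by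
    intro t ht y
    have ht : 0 < t := ht
    have := hg y
    simp only [hk]; positivity
  have hin : ∀ t ∈ Set.Ioi (0 : ℝ), Complex.exp (t * 1 * 0) *
      ∫ y, complexHeatKernel d (t * 1) (x - y) * f y = ((∫ y, k t y : ℝ) : ℂ) := by
    intro t ht
    rw [mul_zero, Complex.exp_zero, one_mul, ← integral_complex_ofReal]
    refine integral_congr_ae (Filter.Eventually.of_forall fun y => ?_)
    simp only [mul_one, complexHeatKernel_ofReal (Set.mem_Ioi.1 ht), hfg, hk]
    push_cast; ring
  have hi' : IntegrableOn (fun t => ∫ y, k t y) (Set.Ioi 0) := by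
    have := (hi.congr_fun hin measurableSet_Ioi).re
    simpa [IntegrableOn] using this
  have hki : ∀ t ∈ Set.Ioi (0 : ℝ), Integrable (k t) := by
    intro t ht
    have ht : 0 < t := ht
    refine hgi.bdd_mul (c := (4 * Real.pi * t) ^ (-((d : ℝ) / 2)))
      (Continuous.aestronglyMeasurable (by fun_prop)) (Filter.Eventually.of_forall fun y => ?_)
    rw [Real.norm_eq_abs, abs_of_pos (by positivity)]
    refine mul_le_of_le_one_right (by positivity) (Real.exp_le_one_iff.2 ?_)
    exact div_nonpos_of_nonpos_of_nonneg (by simp) (by positivity)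
  have hout : 0 ≤ ∫ t in Set.Ioi (0 : ℝ), ∫ y, k t y :=
    setIntegral_nonneg measurableSet_Ioi fun t ht => integral_nonneg (hk0 t ht)
  have hkm : Measurable (Function.uncurry fun t y => ENNReal.ofReal (k t y)) := by
    simp only [hk]
    unfold Function.uncurry
    fun_prop
  rw [heq, one_mul, setIntegral_congr_fun measurableSet_Ioi hin, integral_complex_ofReal,
    ← ofReal_norm, Complex.norm_real, Real.norm_eq_abs, abs_of_nonneg hout,
    ofReal_integral_eq_lintegral_ofReal hi' ((ae_restrict_iff' measurableSet_Ioi).2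
      (Filter.Eventually.of_forall fun t ht => integral_nonneg (hk0 t ht)))]
  calc _ ≤ ∫⁻ y, ∫⁻ t in Set.Ioi (0 : ℝ), ENNReal.ofReal (k t y) := by
        rw [← lintegral_const_mul' _ _ (by simp)]
        refine lintegral_mono fun y => ?_
        -- keep only the times `S < t ≤ 2 S`, on which the kernel is comparable to `S^{-d/2}`
        set S : ℝ := 1 + ‖x - y‖ ^ 2 with hS
        have hS1 : 1 ≤ S := by rw [hS]; nlinarith [norm_nonneg (x - y)]
        have hS0 : 0 < S := by linarith
        calc _ = ∫⁻ t in Set.Ioc S (2 * S), ENNReal.ofReal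
              ((8 * Real.pi * S) ^ (-((d : ℝ) / 2)) * Real.exp (-(1 / 4)) * g y) := by
              rw [setLIntegral_const, Real.volume_Ioc, ← ENNReal.ofReal_mul (by positivity),
                ← ENNReal.ofReal_mul (mul_nonneg (by positivity) (hg y))]
              congr 1
              rw [Real.mul_rpow (by positivity) hS0.le, sub_eq_neg_add 1, Real.rpow_add hS0,
                Real.rpow_one]
              ring
          _ ≤ ∫⁻ t in Set.Ioc S (2 * S), ENNReal.ofReal (k t y) := by
              refine setLIntegral_mono_ae' measurableSet_Ioc
                (Filter.Eventually.of_forall fun t ht => ENNReal.ofReal_le_ofReal ?_)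
              have ht0 : 0 < t := hS0.trans ht.1
              simp only [hk]
              refine mul_le_mul_of_nonneg_right ?_ (hg y)
              refine mul_le_mul ?_ (Real.exp_le_exp.2 ?_) (by positivity) (by positivity)
              · refine Real.rpow_le_rpow_of_nonpos (by positivity) ?_ ?_
                · nlinarith [Real.pi_pos, ht.2]
                · have : (0 : ℝ) ≤ d := by positivity
                  linarith
              · rw [neg_div, neg_le_neg_iff, div_le_div_iff₀ (by positivity) (by norm_num)]
                nlinarith [ht.1]
          _ ≤ _ := lintegral_mono_set fun t ht => hS0.trans ht.1
    _ = ∫⁻ t in Set.Ioi (0 : ℝ), ∫⁻ y, ENNReal.ofReal (k t y) :=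
        (lintegral_lintegral_swap hkm.aemeasurable).symm
    _ = _ := by
        refine setLIntegral_congr_fun measurableSet_Ioi fun t ht => ?_
        exact (ofReal_integral_eq_lintegral_ofReal (hki t ht)
          (Filter.Eventually.of_forall (hk0 t ht))).symm

/-! ### Young's inequality and integrability of the majorant -/

lemma measurable_conv {K f : EuclideanSpace ℝ (Fin d) → ℝ≥0∞} (hK : Measurable K)
    (hf : Measurable f) : Measurable fun x => ∫⁻ y, K (x - y) * f y := by
  refine Measurable.lintegral_prod_right' (f := fun p : EuclideanSpace ℝ (Fin d) ×
    EuclideanSpace ℝ (Fin d) => K (p.1 - p.2) * f p.2) ?_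
  fun_prop

lemma lintegral_conv {K f : EuclideanSpace ℝ (Fin d) → ℝ≥0∞} (hK : Measurable K)
    (hf : Measurable f) :
    ∫⁻ x, ∫⁻ y, K (x - y) * f y = (∫⁻ x, K x) * ∫⁻ y, f y := by
  rw [lintegral_lintegral_swap (by unfold Function.uncurry; fun_prop)]
  have : ∀ y, ∫⁻ x, K (x - y) * f y = (∫⁻ x, K x) * f y := by
    intro y
    rw [lintegral_mul_const _ (by fun_prop), lintegral_sub_right_eq_self]
  simp_rw [this]
  rw [lintegral_const_mul _ hf]

/-- The pointwise form of Young's convolution inequality, with `α = 1/q`, `β = 1/r`, `γ = 1/p`: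
Hölder with the three exponents `α`, `β - α`, `γ - α`. -/
lemma conv_le_of_exponents {K f : EuclideanSpace ℝ (Fin d) → ℝ≥0∞} (hK : Measurable K)
    (hf : Measurable f) {α β γ : ℝ} (hα : 0 ≤ α) (hαβ : α ≤ β) (hαγ : α ≤ γ) (hβ : 0 < β)
    (hγ : 0 < γ) (h : 1 + α = β + γ) (x : EuclideanSpace ℝ (Fin d)) :
    ∫⁻ y, K (x - y) * f y ≤ (∫⁻ y, K (x - y) ^ (1 / β) * f y ^ (1 / γ)) ^ α *
      ((∫⁻ y, K y ^ (1 / β)) ^ (β - α) * (∫⁻ y, f y ^ (1 / γ)) ^ (γ - α)) := by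
  have H := ENNReal.lintegral_prod_norm_pow_le
    (μ := (volume : Measure (EuclideanSpace ℝ (Fin d)))) (Finset.univ : Finset (Fin 3))
    (f := ![fun y => K (x - y) ^ (1 / β) * f y ^ (1 / γ), fun y => K (x - y) ^ (1 / β),
      fun y => f y ^ (1 / γ)]) (p := ![α, β - α, γ - α])
    (by
      intro i _
      fin_cases i <;> simp only [Fin.zero_eta, Fin.mk_one, Fin.reduceFinMk, Matrix.cons_val] <;>
        refine Measurable.aemeasurable ?_ <;> fun_prop)
    (by simp [Fin.sum_univ_three]; linarith)
    (by
      intro i _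
      fin_cases i <;> simp only [Fin.zero_eta, Fin.mk_one, Fin.reduceFinMk, Matrix.cons_val] <;>
        linarith)
  simp only [Fin.prod_univ_three, Matrix.cons_val_zero, Matrix.cons_val_one, Matrix.cons_val] at H
  rw [lintegral_sub_left_eq_self (fun y => K y ^ (1 / β)) x, mul_assoc] at H
  refine le_trans (le_of_eq ?_) H
  refine lintegral_congr fun y => ?_
  rw [ENNReal.mul_rpow_of_nonneg _ _ hα, ← ENNReal.rpow_mul, ← ENNReal.rpow_mul,
    ← ENNReal.rpow_mul, ← ENNReal.rpow_mul, mul_right_comm (K (x - y) ^ _), mul_assoc,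
    ← ENNReal.rpow_add_of_nonneg _ _ (by positivity)
      (mul_nonneg (by positivity) (sub_nonneg.2 hαβ)),
    ← ENNReal.rpow_add_of_nonneg _ _ (by positivity)
      (mul_nonneg (by positivity) (sub_nonneg.2 hαγ)),
    show 1 / β * α + 1 / β * (β - α) = 1 by field_simp; ring,
    show 1 / γ * α + 1 / γ * (γ - α) = 1 by field_simp; ring, ENNReal.rpow_one, ENNReal.rpow_one]

/-- Young's convolution inequality in integrated form, `α = 1/q`, `β = 1/r`, `γ = 1/p`. -/
lemma lintegral_conv_rpow_le {K f : EuclideanSpace ℝ (Fin d) → ℝ≥0∞} (hK : Measurable K)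
    (hf : Measurable f) {α β γ : ℝ} (hα : 0 < α) (hαβ : α ≤ β) (hαγ : α ≤ γ)
    (h : 1 + α = β + γ) :
    (∫⁻ x, (∫⁻ y, K (x - y) * f y) ^ (1 / α)) ^ α ≤
      (∫⁻ y, K y ^ (1 / β)) ^ β * (∫⁻ y, f y ^ (1 / γ)) ^ γ := by
  have hβ : 0 < β := hα.trans_le hαβ
  have hγ : 0 < γ := hα.trans_le hαγ
  set R : ℝ≥0∞ := (∫⁻ y, K y ^ (1 / β)) ^ (β - α) * (∫⁻ y, f y ^ (1 / γ)) ^ (γ - α) with hR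
  have h1 : ∫⁻ x, (∫⁻ y, K (x - y) * f y) ^ (1 / α) ≤
      ((∫⁻ y, K y ^ (1 / β)) * (∫⁻ y, f y ^ (1 / γ))) * R ^ (1 / α) := by
    calc _ ≤ ∫⁻ x, (∫⁻ y, K (x - y) ^ (1 / β) * f y ^ (1 / γ)) * R ^ (1 / α) := by
          refine lintegral_mono fun x => ?_
          calc _ ≤ ((∫⁻ y, K (x - y) ^ (1 / β) * f y ^ (1 / γ)) ^ α * R) ^ (1 / α) :=
                ENNReal.rpow_le_rpow
                  (conv_le_of_exponents hK hf hα.le hαβ hαγ hβ hγ h x) (by positivity)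
            _ = _ := by
                rw [ENNReal.mul_rpow_of_nonneg _ _ (by positivity), ← ENNReal.rpow_mul,
                  mul_one_div_cancel hα.ne', ENNReal.rpow_one]
      _ = _ := by
          rw [lintegral_mul_const _ (measurable_conv (hK.pow_const _) (hf.pow_const _)),
            lintegral_conv (hK.pow_const _) (hf.pow_const _)]
  refine (ENNReal.rpow_le_rpow h1 hα.le).trans (le_of_eq ?_)
  rw [ENNReal.mul_rpow_of_nonneg _ _ hα.le, ← ENNReal.rpow_mul, one_div_mul_cancel hα.ne',
    ENNReal.rpow_one, ENNReal.mul_rpow_of_nonneg _ _ hα.le, hR, mul_mul_mul_comm,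
    ← ENNReal.rpow_add_of_nonneg _ _ hα.le (by linarith),
    ← ENNReal.rpow_add_of_nonneg _ _ hα.le (by linarith)]
  congr 2 <;> ring_nf

lemma measurable_gaussianProfile_right (a t : ℝ) : Measurable (gaussianProfile d a t) := by
  unfold gaussianProfile; fun_prop

/-- The `L^r` norms of the Gaussian profiles. -/
lemma lintegral_gaussianProfile_rpow {a t r : ℝ} (ha : 0 < a) (ht : 0 < t) (hr : 0 < r) :
    ∫⁻ x, gaussianProfile d a t x ^ r = ENNReal.ofReal ((Real.pi / (a * r)) ^ ((d : ℝ) / 2)) *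
      ENNReal.ofReal (t ^ (-((d : ℝ) / 2) * r + d / 2)) := by
  have hb : 0 < a * r / t := by positivity
  have e : ∀ x : EuclideanSpace ℝ (Fin d), gaussianProfile d a t x ^ r =
      ENNReal.ofReal (t ^ (-((d : ℝ) / 2) * r)) *
        ENNReal.ofReal (Real.exp (-(a * r / t) * ‖x‖ ^ 2)) := by
    intro x
    rw [gaussianProfile, ENNReal.ofReal_rpow_of_nonneg (by positivity) hr.le,
      Real.mul_rpow (by positivity) (by positivity), ENNReal.ofReal_mul (by positivity),
      ← Real.rpow_mul ht.le, ← Real.exp_mul]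
    congr 3
    ring
  have hI := GaussianFourier.integral_rexp_neg_mul_sq_norm
    (V := EuclideanSpace ℝ (Fin d)) hb
  have hint : Integrable fun x : EuclideanSpace ℝ (Fin d) =>
      Real.exp (-(a * r / t) * ‖x‖ ^ 2) := by
    by_contra hcon
    rw [integral_undef hcon] at hI
    have : 0 < (Real.pi / (a * r / t)) ^
      ((Module.finrank ℝ (EuclideanSpace ℝ (Fin d)) : ℝ) / 2) := by positivity
    linarith
  simp_rw [e]
  rw [lintegral_const_mul _ (by fun_prop), ← ofReal_integral_eq_lintegral_ofReal hint
    (Filter.Eventually.of_forall fun x => (Real.exp_pos _).le), hI,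
    ← ENNReal.ofReal_mul (by positivity), ← ENNReal.ofReal_mul (by positivity)]
  congr 1
  rw [finrank_euclideanSpace, Fintype.card_fin, Real.rpow_add ht,
    show Real.pi / (a * r / t) = Real.pi / (a * r) * t by field_simp,
    Real.mul_rpow (by positivity) ht.le]
  ring

lemma lintegral_gaussianProfile {a t : ℝ} (ha : 0 < a) (ht : 0 < t) :
    ∫⁻ x, gaussianProfile d a t x = ENNReal.ofReal ((Real.pi / a) ^ ((d : ℝ) / 2)) := by
  simpa using lintegral_gaussianProfile_rpow (d := d) ha ht one_pos

/-- The majorant lies in `L^r` whenever `1 ≤ r` and `(d/2)(1 - 1/r) < 1`. -/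
lemma lintegral_resolventMajorant_rpow_lt_top {a c r : ℝ} (ha : 0 < a) (hc : 0 < c) (hr : 1 ≤ r)
    (hσ : (d : ℝ) / 2 * (1 - 1 / r) < 1) :
    ∫⁻ x, resolventMajorant d a c x ^ r < ∞ := by
  have hr0 : 0 < r := by linarith
  have h1r : 0 ≤ 1 - 1 / r := by rw [sub_nonneg, div_le_one hr0]; exact hr
  set σ : ℝ := (d : ℝ) / 2 * (1 - 1 / r) with hσ_def
  -- `W` is integrable as `σ < 1`, and the powers of `t` in `∫ V t x dx` cancel
  obtain ⟨W, hW⟩ : ∃ W : ℝ → ℝ≥0∞, W = fun t =>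
    ENNReal.ofReal (t ^ (-σ) * Real.exp (-c * t ^ (1 : ℝ))) := ⟨_, rfl⟩
  have hWm : Measurable W := by rw [hW]; fun_prop
  have hWfin : ∫⁻ t in Set.Ioi (0 : ℝ), W t < ∞ := by
    rw [hW]
    exact (integrableOn_rpow_mul_exp_neg_mul_rpow (by linarith) one_pos hc).lintegral_lt_top
  obtain ⟨V, hV⟩ : ∃ V : ℝ → EuclideanSpace ℝ (Fin d) → ℝ≥0∞, V = fun t x =>
    W t * ENNReal.ofReal (t ^ (σ * r)) * gaussianProfile d a t x ^ r := ⟨_, rfl⟩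
  have hVm : Measurable (Function.uncurry V) := by
    rw [hV]; unfold Function.uncurry; fun_prop
  -- Hölder in `t` with respect to the finite measure `W t dt`
  have hpt : ∀ x, resolventMajorant d a c x ^ r ≤
      (∫⁻ t in Set.Ioi (0 : ℝ), V t x) * (∫⁻ t in Set.Ioi (0 : ℝ), W t) ^ (r - 1) := by
    intro x
    have hVx : Measurable fun t => V t x := hVm.of_uncurry_right
    have h2 : resolventMajorant d a c x ≤ (∫⁻ t in Set.Ioi (0 : ℝ), V t x) ^ (1 / r) *
        (∫⁻ t in Set.Ioi (0 : ℝ), W t) ^ (1 - 1 / r) := by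
      refine le_trans (le_of_eq ?_) (ENNReal.lintegral_mul_norm_pow_le hVx.aemeasurable
        hWm.aemeasurable (by positivity) h1r (by ring))
      refine setLIntegral_congr_fun measurableSet_Ioi fun t ht => ?_
      have ht : 0 < t := ht
      simp only [hV]
      rw [ENNReal.mul_rpow_of_nonneg _ _ (by positivity), ENNReal.mul_rpow_of_nonneg _ _
        (by positivity), ← ENNReal.rpow_mul, mul_one_div_cancel hr0.ne', ENNReal.rpow_one,
        mul_right_comm, mul_right_comm (W t ^ _), ← ENNReal.rpow_add_of_nonneg _ _ (by positivity)
        h1r, add_sub_cancel, ENNReal.rpow_one]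
      congr 1
      rw [ENNReal.ofReal_rpow_of_nonneg (by positivity) (by positivity), ← Real.rpow_mul ht.le,
        mul_assoc σ, mul_one_div_cancel hr0.ne', mul_one]
      simp only [hW]
      rw [← ENNReal.ofReal_mul (by positivity), mul_right_comm, ← Real.rpow_add ht,
        neg_add_cancel, Real.rpow_zero, one_mul, Real.rpow_one, neg_mul]
    calc _ ≤ ((∫⁻ t in Set.Ioi (0 : ℝ), V t x) ^ (1 / r) *
          (∫⁻ t in Set.Ioi (0 : ℝ), W t) ^ (1 - 1 / r)) ^ r := ENNReal.rpow_le_rpow h2 hr0.le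
      _ = _ := by
          rw [ENNReal.mul_rpow_of_nonneg _ _ hr0.le, ← ENNReal.rpow_mul, ← ENNReal.rpow_mul,
            one_div_mul_cancel hr0.ne', ENNReal.rpow_one]
          congr 2
          field_simp
  refine (lintegral_mono hpt).trans_lt ?_
  rw [lintegral_mul_const' _ _ (ENNReal.rpow_ne_top_of_nonneg (by linarith) hWfin.ne)]
  refine ENNReal.mul_lt_top ?_ (ENNReal.rpow_lt_top_of_nonneg (by linarith) hWfin.ne)
  have hVm' : Measurable (Function.uncurry fun x t => V t x) := hVm.comp measurable_swap
  rw [lintegral_lintegral_swap hVm'.aemeasurable]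
  have hin : ∀ t ∈ Set.Ioi (0 : ℝ), ∫⁻ x, V t x =
      W t * ENNReal.ofReal ((Real.pi / (a * r)) ^ ((d : ℝ) / 2)) := by
    intro t ht
    have ht : 0 < t := ht
    simp only [hV]
    rw [lintegral_const_mul _ ((measurable_gaussianProfile_right a t).pow_const r),
      lintegral_gaussianProfile_rpow ha ht hr0, mul_assoc]
    congr 1
    rw [mul_left_comm, ← ENNReal.ofReal_mul (by positivity), ← Real.rpow_add ht,
      show σ * r + (-((d : ℝ) / 2) * r + d / 2) = 0 by rw [hσ_def]; field_simp; ring,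
      Real.rpow_zero, ENNReal.ofReal_one, mul_one]
  rw [setLIntegral_congr_fun measurableSet_Ioi hin, lintegral_mul_const _ hWm]
  exact ENNReal.mul_lt_top hWfin ENNReal.ofReal_lt_top

/-! ### The Hardy–Littlewood–Sobolev inequality for the majorant -/

/-- Integral of the Gaussian profiles over a set `S` of times. -/
def truncatedMajorant (d : ℕ) (a : ℝ) (S : Set ℝ) (x : EuclideanSpace ℝ (Fin d)) : ℝ≥0∞ :=
  ∫⁻ t in S, gaussianProfile d a t x

lemma measurable_truncatedMajorant (a : ℝ) (S : Set ℝ) : Measurable (truncatedMajorant d a S) := by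
  unfold truncatedMajorant
  exact Measurable.lintegral_prod_left' (measurable_gaussianProfile a)

lemma resolventMajorant_le_add {a c T : ℝ} (hc : 0 ≤ c) (hT : 0 < T)
    (x : EuclideanSpace ℝ (Fin d)) :
    resolventMajorant d a c x ≤
      truncatedMajorant d a (Set.Ioc 0 T) x + truncatedMajorant d a (Set.Ioi T) x := by
  calc _ ≤ ∫⁻ t in Set.Ioi (0 : ℝ), gaussianProfile d a t x := by
        refine setLIntegral_mono_ae' measurableSet_Ioi (Filter.Eventually.of_forall fun t ht => ?_)
        refine mul_le_of_le_one_left' (ENNReal.ofReal_le_one.2 (Real.exp_le_one_iff.2 ?_))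
        have : 0 ≤ c * t := mul_nonneg hc (le_of_lt ht)
        linarith
    _ ≤ _ := by
        rw [← Set.Ioc_union_Ioi_eq_Ioi hT.le]
        exact lintegral_union_le _ _ _

lemma lintegral_truncatedMajorant_Ioc {a T : ℝ} (ha : 0 < a) :
    ∫⁻ x, truncatedMajorant d a (Set.Ioc 0 T) x =
      ENNReal.ofReal ((Real.pi / a) ^ ((d : ℝ) / 2)) * ENNReal.ofReal T := by
  unfold truncatedMajorant
  have hm : Measurable (Function.uncurry fun (x : EuclideanSpace ℝ (Fin d)) t =>
    gaussianProfile d a t x) := (measurable_gaussianProfile a).comp measurable_swap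
  rw [lintegral_lintegral_swap hm.aemeasurable,
    setLIntegral_congr_fun measurableSet_Ioc fun t ht => lintegral_gaussianProfile ha ht.1,
    setLIntegral_const, Real.volume_Ioc, sub_zero]

/-- Convolution with the late-time part of the kernel, by Hölder at each time. The time integral
converges because `d / (2p) > 1`. -/
lemma exists_conv_truncatedMajorant_Ioi_le {a p : ℝ} (ha : 0 < a) (hp : 1 < p)
    (hpd : 1 < (d : ℝ) / (2 * p)) : ∃ A : ℝ≥0∞, A ≠ ∞ ∧
    ∀ f : EuclideanSpace ℝ (Fin d) → ℝ≥0∞, Measurable f → ∫⁻ y, f y ^ p ≤ 1 →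
      ∀ T : ℝ, 0 < T → ∀ x, ∫⁻ y, truncatedMajorant d a (Set.Ioi T) (x - y) * f y ≤
        A * ENNReal.ofReal (T ^ (1 - (d : ℝ) / (2 * p))) := by
  have hp0 : 0 < p := by linarith
  set θ : ℝ := 1 - 1 / p with hθ
  have hθ0 : 0 < θ := by
    have : 1 / p < 1 := by rw [div_lt_one hp0]; exact hp
    rw [hθ]; linarith
  set B : ℝ≥0∞ := ENNReal.ofReal ((Real.pi / (a * (1 / θ))) ^ ((d : ℝ) / 2)) ^ θ with hB
  have hBtop : B ≠ ∞ := ENNReal.rpow_ne_top_of_nonneg hθ0.le ENNReal.ofReal_ne_top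
  refine ⟨B * ENNReal.ofReal ((d : ℝ) / (2 * p) - 1)⁻¹, ENNReal.mul_ne_top hBtop (by simp), ?_⟩
  intro f hf hf1 T hT x
  have hG : Measurable fun q : ℝ × EuclideanSpace ℝ (Fin d) =>
      gaussianProfile d a q.1 (x - q.2) := (measurable_gaussianProfile a).comp
      (f := fun q : ℝ × EuclideanSpace ℝ (Fin d) => (q.1, x - q.2)) (by fun_prop)
  have hGt : ∀ t, Measurable fun y => gaussianProfile d a t (x - y) := fun t =>
    (measurable_gaussianProfile_right a t).comp (by fun_prop)
  calc _ = ∫⁻ y, ∫⁻ t in Set.Ioi T, gaussianProfile d a t (x - y) * f y := by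
        refine lintegral_congr fun y => ?_
        rw [truncatedMajorant, lintegral_mul_const _ (hG.of_uncurry_right
          (f := fun t y => gaussianProfile d a t (x - y)))]
    _ = ∫⁻ t in Set.Ioi T, ∫⁻ y, gaussianProfile d a t (x - y) * f y := by
        refine lintegral_lintegral_swap (Measurable.aemeasurable ?_)
        unfold Function.uncurry
        exact (hG.comp measurable_swap).mul (hf.comp measurable_fst)
    _ ≤ ∫⁻ t in Set.Ioi T, B * ENNReal.ofReal (t ^ (-((d : ℝ) / (2 * p)))) := by
        refine setLIntegral_mono_ae' measurableSet_Ioi (Filter.Eventually.of_forall fun t ht => ?_)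
        have ht0 : 0 < t := hT.trans ht
        have H := ENNReal.lintegral_mul_norm_pow_le (μ := volume)
          ((hGt t).pow_const (1 / θ)).aemeasurable
          (hf.pow_const p).aemeasurable (p := θ) (q := 1 / p) hθ0.le (by positivity)
          (by rw [hθ]; ring)
        simp_rw [← ENNReal.rpow_mul, one_div_mul_cancel hθ0.ne', mul_one_div_cancel hp0.ne',
          ENNReal.rpow_one] at H
        refine H.trans ?_
        rw [lintegral_sub_left_eq_self (fun y => gaussianProfile d a t y ^ (1 / θ)) x,
          lintegral_gaussianProfile_rpow ha ht0 (by positivity),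
          ENNReal.mul_rpow_of_nonneg _ _ hθ0.le, ← hB,
          ENNReal.ofReal_rpow_of_nonneg (by positivity) hθ0.le, ← Real.rpow_mul ht0.le,
          show (-((d : ℝ) / 2) * (1 / θ) + d / 2) * θ = -((d : ℝ) / (2 * p)) by
            rw [add_mul, mul_assoc, one_div_mul_cancel hθ0.ne', hθ]; field_simp; ring]
        exact mul_le_of_le_one_right' (ENNReal.rpow_le_one hf1 (by positivity))
    _ = _ := by
        have hlt : -((d : ℝ) / (2 * p)) < -1 := by linarith
        rw [lintegral_const_mul' _ _ hBtop, ← ofReal_integral_eq_lintegral_ofReal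
          (integrableOn_Ioi_rpow_of_lt hlt hT) ((ae_restrict_iff' measurableSet_Ioi).2
            (Filter.Eventually.of_forall fun t ht => Real.rpow_nonneg (hT.trans ht).le _)),
          integral_Ioi_rpow_of_lt hlt hT, mul_assoc,
          ← ENNReal.ofReal_mul (inv_nonneg.2 (by linarith))]
        congr 2
        rw [show -((d : ℝ) / (2 * p)) + 1 = -((d : ℝ) / (2 * p) - 1) by ring, neg_div_neg_eq,
          show -((d : ℝ) / (2 * p) - 1) = 1 - (d : ℝ) / (2 * p) by ring]
        field_simp

/-- Integrating a power of the level `s` over the range `s^b < F` on which the truncation at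
height `s^b` is active. -/
lemma mul_lintegral_rpow_lt {b e p : ℝ} (hb : 0 < b) (he : -1 < e) (hp : 0 < p)
    (h : 1 + (e + 1) / b = p) (F : ℝ≥0∞) (hF : F ≠ ∞) :
    F * ∫⁻ s in Set.Ioi (0 : ℝ), {s : ℝ | ENNReal.ofReal (s ^ b) < F}.indicator
      (fun s => ENNReal.ofReal (s ^ e)) s = ENNReal.ofReal (e + 1)⁻¹ * F ^ p := by
  obtain ⟨u, hu0, rfl⟩ : ∃ u : ℝ, 0 ≤ u ∧ F = ENNReal.ofReal u :=
    ⟨F.toReal, ENNReal.toReal_nonneg, (ENNReal.ofReal_toReal hF).symm⟩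
  rcases hu0.eq_or_lt with rfl | hu
  · simp [ENNReal.zero_rpow_of_pos hp]
  have hset : ∀ s ∈ Set.Ioi (0 : ℝ), {s : ℝ | ENNReal.ofReal (s ^ b) < ENNReal.ofReal u}.indicator
      (fun s => ENNReal.ofReal (s ^ e)) s =
      (Set.Iio (u ^ (1 / b))).indicator (fun s => ENNReal.ofReal (s ^ e)) s := by
    intro s hs
    have hs : 0 < s := hs
    have : s ∈ {s : ℝ | ENNReal.ofReal (s ^ b) < ENNReal.ofReal u} ↔ s ∈ Set.Iio (u ^ (1 / b)) := by
      simp only [Set.mem_ofPred_eq, Set.mem_Iio, ENNReal.ofReal_lt_ofReal_iff hu]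
      rw [one_div, Real.lt_rpow_inv_iff_of_pos hs.le hu0 hb]
    by_cases hmem : s ∈ Set.Iio (u ^ (1 / b))
    · rw [Set.indicator_of_mem hmem, Set.indicator_of_mem (this.2 hmem)]
    · rw [Set.indicator_of_notMem hmem, Set.indicator_of_notMem (fun h => hmem (this.1 h))]
  have hL : 0 < u ^ (1 / b) := Real.rpow_pos_of_pos hu _
  rw [setLIntegral_congr_fun measurableSet_Ioi hset, lintegral_indicator measurableSet_Iio,
    Measure.restrict_restrict measurableSet_Iio, Set.inter_comm, Set.Ioi_inter_Iio,
    ← ofReal_integral_eq_lintegral_ofReal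
      ((intervalIntegral.integrableOn_Ioo_rpow_iff hL).2 he)
      ((ae_restrict_iff' measurableSet_Ioo).2 (Filter.Eventually.of_forall fun s hs =>
        Real.rpow_nonneg hs.1.le _)), ← integral_Ioc_eq_integral_Ioo,
    ← intervalIntegral.integral_of_le hL.le, integral_rpow (Or.inl he),
    Real.zero_rpow (by linarith), sub_zero, ENNReal.ofReal_rpow_of_pos hu,
    ← ENNReal.ofReal_mul hu.le, ← ENNReal.ofReal_mul (inv_nonneg.2 (by linarith)),
    ← Real.rpow_mul hu.le, ← h, Real.rpow_add hu, Real.rpow_one]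
  congr 1
  rw [show 1 / b * (e + 1) = (e + 1) / b by ring]
  field_simp

/-- The level-set estimate behind the Hardy–Littlewood–Sobolev inequality: at level `s` the kernel
is cut at time `T = s^{-2q/d}` and the function at height `s / T = s^{q/p}`, so that all but
one of the resulting pieces are pointwise at most a multiple of `s`. -/
lemma meas_lt_conv_le {a c p q : ℝ} (ha : 0 < a) (hc : 0 ≤ c) (hp : 0 < p) (hq : 0 < q)
    (hd : 0 < d) (hpq : 1 / p - 1 / q = 2 / d) {A : ℝ≥0∞}
    {f : EuclideanSpace ℝ (Fin d) → ℝ≥0∞} (hf : Measurable f)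
    (hlate : ∀ T : ℝ, 0 < T → ∀ x, ∫⁻ y, truncatedMajorant d a (Set.Ioi T) (x - y) * f y ≤
        A * ENNReal.ofReal (T ^ (1 - (d : ℝ) / (2 * p)))) {s : ℝ} (hs : 0 < s) :
    volume {x | (A + ENNReal.ofReal ((Real.pi / a) ^ ((d : ℝ) / 2)) + 1) * ENNReal.ofReal s <
        ∫⁻ y, resolventMajorant d a c (x - y) * f y} ≤
      ENNReal.ofReal ((Real.pi / a) ^ ((d : ℝ) / 2)) * (ENNReal.ofReal (s ^ (-(q / p))) *
        ∫⁻ y, {y | ENNReal.ofReal (s ^ (q / p)) < f y}.indicator f y) := by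
  have hd' : (0 : ℝ) < d := by exact_mod_cast hd
  set B : ℝ≥0∞ := ENNReal.ofReal ((Real.pi / a) ^ ((d : ℝ) / 2)) with hB
  have hBtop : B ≠ ∞ := ENNReal.ofReal_ne_top
  have hqp : q / p = 1 + 2 * q / d := by
    field_simp at hpq ⊢
    linarith
  obtain ⟨T, hT⟩ : ∃ T : ℝ, T = s ^ (-(2 * q / d)) := ⟨_, rfl⟩
  have hT0 : 0 < T := by rw [hT]; positivity
  have hTlate : T ^ (1 - (d : ℝ) / (2 * p)) = s := by
    rw [hT, ← Real.rpow_mul hs.le, show -(2 * q / d) * (1 - (d : ℝ) / (2 * p)) = q / p - 2 * q / d by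
      field_simp; ring, hqp, add_sub_cancel_right, Real.rpow_one]
  have hTh : T * s ^ (q / p) = s := by
    rw [hT, hqp, ← Real.rpow_add hs, show -(2 * q / d) + (1 + 2 * q / d) = 1 by ring, Real.rpow_one]
  have hTs : T / s = s ^ (-(q / p)) := by
    rw [hT, hqp, neg_add, Real.rpow_add hs, Real.rpow_neg_one]
    ring
  set E : Set (EuclideanSpace ℝ (Fin d)) := {y | ENNReal.ofReal (s ^ (q / p)) < f y} with hE
  have hEm : MeasurableSet E := measurableSet_lt measurable_const hf
  set K := truncatedMajorant d a (Set.Ioc 0 T) with hK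
  have hKm : Measurable K := measurable_truncatedMajorant a _
  have hKi : ∫⁻ x, K x = B * ENNReal.ofReal T := lintegral_truncatedMajorant_Ioc ha
  have hfE : Measurable (E.indicator f) := hf.indicator hEm
  have hsplit : ∀ x, ∫⁻ y, resolventMajorant d a c (x - y) * f y ≤
      (A + B) * ENNReal.ofReal s + ∫⁻ y, K (x - y) * E.indicator f y := by
    intro x
    have hK' : Measurable fun y => K (x - y) := hKm.comp (by fun_prop)
    calc _ ≤ ∫⁻ y, (truncatedMajorant d a (Set.Ioi T) (x - y) * f y +
          (K (x - y) * ENNReal.ofReal (s ^ (q / p)) + K (x - y) * E.indicator f y)) := by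
          refine lintegral_mono fun y => ?_
          refine (mul_le_mul_left (resolventMajorant_le_add hc hT0 _) _).trans ?_
          rw [add_mul, add_comm, ← mul_add]
          gcongr
          by_cases hy : y ∈ E
          · rw [Set.indicator_of_mem hy]; exact le_add_self
          · exact (not_lt.1 hy).trans le_self_add
      _ = (∫⁻ y, truncatedMajorant d a (Set.Ioi T) (x - y) * f y) +
          ((∫⁻ y, K (x - y)) * ENNReal.ofReal (s ^ (q / p)) +
            ∫⁻ y, K (x - y) * E.indicator f y) := by
          rw [lintegral_add_right _ (by fun_prop), lintegral_add_right _ (by fun_prop),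
            lintegral_mul_const _ hK']
      _ ≤ A * ENNReal.ofReal s + (B * ENNReal.ofReal s +
            ∫⁻ y, K (x - y) * E.indicator f y) := by
          refine add_le_add ((hlate T hT0 x).trans_eq (by rw [hTlate]))
            (add_le_add (le_of_eq ?_) le_rfl)
          rw [lintegral_sub_left_eq_self K x, hKi, mul_assoc, ← ENNReal.ofReal_mul hT0.le, hTh]
      _ = _ := by rw [add_mul, add_assoc]
  have hs0 : ENNReal.ofReal s ≠ 0 := (ENNReal.ofReal_pos.2 hs).ne'
  calc _ ≤ volume {x | ENNReal.ofReal s ≤ ∫⁻ y, K (x - y) * E.indicator f y} := by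
        refine measure_mono fun x hx => ?_
        have h1 := lt_of_lt_of_le hx (hsplit x)
        rw [add_mul, one_mul] at h1
        exact (lt_of_add_lt_add_left h1).le
    _ ≤ (∫⁻ x, ∫⁻ y, K (x - y) * E.indicator f y) / ENNReal.ofReal s :=
        meas_ge_le_lintegral_div (measurable_conv hKm hfE).aemeasurable hs0 ENNReal.ofReal_ne_top
    _ = _ := by
        rw [lintegral_conv hKm hfE, hKi, ← hTs, ENNReal.ofReal_div_of_pos hs, div_eq_mul_inv,
          div_eq_mul_inv]
        ring

/-- The Hardy–Littlewood–Sobolev inequality for the resolvent majorant, for bounded functions: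
the level-set estimate is integrated with the layer cake formula. -/
lemma exists_lintegral_conv_rpow_le {a c p q : ℝ} (ha : 0 < a) (hc : 0 ≤ c) (hp : 1 < p)
    (hq : 0 < q) (hd : 0 < d) (hpq : 1 / p - 1 / q = 2 / d) : ∃ C : ℝ≥0∞, C ≠ ∞ ∧
    ∀ f : EuclideanSpace ℝ (Fin d) → ℝ≥0∞, Measurable f → ∀ M : ℝ≥0∞, M ≠ ∞ → (∀ y, f y ≤ M) →
      ∫⁻ y, f y ^ p ≤ 1 → ∫⁻ x, (∫⁻ y, resolventMajorant d a c (x - y) * f y) ^ q ≤ C := by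
  have hp0 : 0 < p := by linarith
  have hd' : (0 : ℝ) < d := by exact_mod_cast hd
  have hpd : 1 < (d : ℝ) / (2 * p) := by
    have h1 : 2 / (d : ℝ) < 1 / p := by
      have : 0 < 1 / q := by positivity
      linarith
    rw [div_lt_div_iff₀ hd' hp0] at h1
    rw [one_lt_div (by positivity)]; linarith
  obtain ⟨A, hA, hlate⟩ := exists_conv_truncatedMajorant_Ioi_le (d := d) ha hp hpd
  set B : ℝ≥0∞ := ENNReal.ofReal ((Real.pi / a) ^ ((d : ℝ) / 2)) with hB
  have hBtop : B ≠ ∞ := ENNReal.ofReal_ne_top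
  obtain ⟨D, hD0, hD⟩ : ∃ D : ℝ, 0 < D ∧ A + B + 1 = ENNReal.ofReal D := by
    have htop : A + B + 1 ≠ ∞ := by finiteness
    exact ⟨(A + B + 1).toReal, ENNReal.toReal_pos (by simp) htop, (ENNReal.ofReal_toReal htop).symm⟩
  refine ⟨ENNReal.ofReal (D ^ q) * (ENNReal.ofReal q * (B *
    ENNReal.ofReal (q - 1 - q / p + 1)⁻¹)), by finiteness, ?_⟩
  intro f hf M hM hfM hf1
  obtain ⟨g, hg⟩ : ∃ g : EuclideanSpace ℝ (Fin d) → ℝ≥0∞,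
    g = fun x => ∫⁻ y, resolventMajorant d a c (x - y) * f y := ⟨_, rfl⟩
  have hgm : Measurable g := hg ▸ measurable_conv (measurable_resolventMajorant a c) hf
  -- finiteness is what lets the real-valued layer cake formula apply to `g`
  have hgtop : ∀ x, g x ≠ ∞ := by
    intro x
    have hKm := measurable_truncatedMajorant (d := d) a (Set.Ioc 0 1)
    refine ne_top_of_le_ne_top (b := A * ENNReal.ofReal (1 ^ (1 - (d : ℝ) / (2 * p))) +
      B * ENNReal.ofReal 1 * M) (by finiteness) ?_
    calc g x ≤ ∫⁻ y, (truncatedMajorant d a (Set.Ioi 1) (x - y) * f y +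
          truncatedMajorant d a (Set.Ioc 0 1) (x - y) * M) := by
          rw [hg]
          refine lintegral_mono fun y => ?_
          refine (mul_le_mul_left (resolventMajorant_le_add hc one_pos _) _).trans ?_
          rw [add_mul, add_comm]
          gcongr
          exact hfM y
      _ = (∫⁻ y, truncatedMajorant d a (Set.Ioi 1) (x - y) * f y) +
          (∫⁻ y, truncatedMajorant d a (Set.Ioc 0 1) (x - y)) * M := by
          rw [lintegral_add_right _ (by fun_prop), lintegral_mul_const _ (by fun_prop)]
      _ ≤ _ := by
          gcongr
          · exact hlate f hf hf1 1 one_pos x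
          · rw [lintegral_sub_left_eq_self (truncatedMajorant d a (Set.Ioc 0 1)) x,
              lintegral_truncatedMajorant_Ioc ha]
  have hlayer := lintegral_rpow_eq_lintegral_meas_lt_mul (μ := volume)
    (f := fun x => (g x).toReal / D) (Filter.Eventually.of_forall fun x => by positivity)
    (by fun_prop) hq
  have hgD : ∀ x, g x ^ q = ENNReal.ofReal (D ^ q) * ENNReal.ofReal (((g x).toReal / D) ^ q) := by
    intro x
    rw [← ENNReal.ofReal_mul (by positivity), ← Real.mul_rpow hD0.le (by positivity),
      mul_div_cancel₀ _ hD0.ne', ← ENNReal.ofReal_rpow_of_nonneg ENNReal.toReal_nonneg hq.le,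
      ENNReal.ofReal_toReal (hgtop x)]
  have hgoal : ∫⁻ x, (∫⁻ y, resolventMajorant d a c (x - y) * f y) ^ q = ∫⁻ x, g x ^ q := by
    rw [hg]
  rw [hgoal]
  simp_rw [hgD]
  rw [lintegral_const_mul' _ _ ENNReal.ofReal_ne_top, hlayer]
  gcongr
  obtain ⟨H, hH⟩ : ∃ H : ℝ → EuclideanSpace ℝ (Fin d) → ℝ≥0∞, H = fun s y => f y *
    {s : ℝ | ENNReal.ofReal (s ^ (q / p)) < f y}.indicator
      (fun s => ENNReal.ofReal (s ^ (q - 1 - q / p))) s := ⟨_, rfl⟩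
  have hHm : Measurable (Function.uncurry H) := by
    have hS : MeasurableSet {z : ℝ × EuclideanSpace ℝ (Fin d) |
        ENNReal.ofReal (z.1 ^ (q / p)) < f z.2} :=
      measurableSet_lt (by fun_prop) (by fun_prop)
    have : Function.uncurry H = fun z : ℝ × EuclideanSpace ℝ (Fin d) => f z.2 *
        {z : ℝ × EuclideanSpace ℝ (Fin d) | ENNReal.ofReal (z.1 ^ (q / p)) < f z.2}.indicator
          (fun z => ENNReal.ofReal (z.1 ^ (q - 1 - q / p))) z := by
      rw [hH]; rfl
    rw [this]
    exact (hf.comp measurable_snd).mul (Measurable.indicator (by fun_prop) hS)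
  calc _ ≤ ∫⁻ s in Set.Ioi (0 : ℝ), B * ∫⁻ y, H s y := by
        refine setLIntegral_mono_ae' measurableSet_Ioi (Filter.Eventually.of_forall fun s hs => ?_)
        have hs : 0 < s := hs
        have hsub : {x | s < (g x).toReal / D} ⊆ {x | (A + B + 1) * ENNReal.ofReal s <
            ∫⁻ y, resolventMajorant d a c (x - y) * f y} := by
          intro x hx
          have hx : s < (g x).toReal / D := hx
          rw [lt_div_iff₀ hD0] at hx
          have : (A + B + 1) * ENNReal.ofReal s < g x := by
            rw [hD, ← ENNReal.ofReal_mul hD0.le, mul_comm,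
              ENNReal.ofReal_lt_iff_lt_toReal (by positivity) (hgtop x)]
            exact hx
          rw [hg] at this
          exact this
        refine (mul_le_mul_left ((measure_mono hsub).trans (meas_lt_conv_le ha hc hp0 hq hd hpq
          hf (fun T hT x => hlate f hf hf1 T hT x) hs)) _).trans (le_of_eq ?_)
        rw [mul_assoc, mul_right_comm, ← ENNReal.ofReal_mul (by positivity), ← Real.rpow_add hs,
          ← lintegral_const_mul' _ _ ENNReal.ofReal_ne_top]
        congr 1
        refine lintegral_congr fun y => ?_
        rw [hH]
        simp only [Set.indicator_apply, Set.mem_ofPred_eq]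
        split_ifs
        · rw [mul_comm]; congr 3; ring
        · simp
    _ = B * ∫⁻ y, ∫⁻ s in Set.Ioi (0 : ℝ), H s y := by
        rw [lintegral_const_mul' _ _ hBtop, lintegral_lintegral_swap hHm.aemeasurable]
    _ = B * ∫⁻ y, ENNReal.ofReal (q - 1 - q / p + 1)⁻¹ * f y ^ p := by
        congr 1
        refine lintegral_congr fun y => ?_
        have he : -1 < q - 1 - q / p := by
          have : q / p < q := div_lt_self hq hp
          linarith
        rw [hH]
        simp only
        rw [lintegral_const_mul' _ _ (ne_top_of_le_ne_top hM (hfM y))]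
        refine mul_lintegral_rpow_lt (by positivity) he hp0 ?_ _ (ne_top_of_le_ne_top hM (hfM y))
        field_simp; ring
    _ ≤ B * ENNReal.ofReal (q - 1 - q / p + 1)⁻¹ := by
        rw [lintegral_const_mul' _ _ ENNReal.ofReal_ne_top]
        gcongr
        exact mul_le_of_le_one_right' hf1

/-! ### Boundedness of the resolvent inside the region -/

lemma eLpNorm_eq_lintegral_rpow_inv {E : Type*} [NormedAddCommGroup E] {α : Type*}
    [MeasurableSpace α] {μ : Measure α} {p : ℝ≥0∞} (hp : p ≠ 0) (hp' : p ≠ ∞) (f : α → E) :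
    eLpNorm f p μ = (∫⁻ x, ‖f x‖ₑ ^ (1 / (1 / p).toReal) ∂μ) ^ (1 / p).toReal := by
  rw [eLpNorm_eq_lintegral_rpow_enorm_toReal hp hp', ENNReal.toReal_div, ENNReal.toReal_one,
    one_div_one_div]

lemma toReal_one_div_pos {p : ℝ≥0∞} (hp : p ≠ 0) (hp' : p ≠ ∞) : 0 < (1 / p).toReal := by
  rw [ENNReal.toReal_div, ENNReal.toReal_one]
  exact one_div_pos.2 (ENNReal.toReal_pos hp hp')

/-- Bounds for the resolvent below the Sobolev line, from Young's inequality. -/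
lemma exists_eLpNorm_laplaceResolvent_le_of_lt {z : ℂ}
    (hz : z ∉ (fun t : ℝ => (t : ℂ)) '' Set.Ici 0) (hd : 2 ≤ d) {p q : ℝ≥0∞} (hp : 1 ≤ p)
    (hq : 1 ≤ q) (h0 : (1 / q).toReal ≤ (1 / p).toReal)
    (h1 : (1 / p).toReal - (1 / q).toReal < 2 / d) :
    ∃ C : ℝ≥0∞, C ≠ ∞ ∧ ∀ f : 𝓢(EuclideanSpace ℝ (Fin d), ℂ),
      eLpNorm (laplaceResolvent d z f) q volume ≤ C * eLpNorm f p volume := by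
  obtain ⟨a, c, ha, hc, C, hC, hle⟩ := exists_enorm_laplaceResolvent_le (d := d) hz
  have hd2 : (2 : ℝ) ≤ d := by exact_mod_cast hd
  have hK := measurable_resolventMajorant (d := d) a c
  have hp0 : p ≠ 0 := (one_pos.trans_le hp).ne'
  have hq0 : q ≠ 0 := (one_pos.trans_le hq).ne'
  -- `β = 1/r` for the exponent `r` of the kernel in Young's inequality
  set β : ℝ := 1 - ((1 / p).toReal - (1 / q).toReal) with hβ
  have hβ0 : 0 < β := by
    have : 2 / (d : ℝ) ≤ 1 := by rw [div_le_one (by linarith)]; exact hd2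
    linarith
  have hβ1 : β ≤ 1 := by linarith
  have hKr : ∫⁻ x, resolventMajorant d a c x ^ (1 / β) < ∞ := by
    refine lintegral_resolventMajorant_rpow_lt_top ha hc ((one_le_div hβ0).2 hβ1) ?_
    rw [one_div_one_div, show 1 - β = (1 / p).toReal - (1 / q).toReal by rw [hβ]; ring]
    rw [lt_div_iff₀ (by linarith)] at h1
    linarith
  have hq1 : (1 / q).toReal ≤ 1 := by
    rw [ENNReal.toReal_div, ENNReal.toReal_one]
    by_cases hq' : q = ∞
    · simp [hq']
    · exact (div_le_one (ENNReal.toReal_pos hq0 hq')).2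
        (by simpa using ENNReal.toReal_mono hq' hq)
  have hp1 : (1 / p).toReal ≤ 1 := by
    rw [ENNReal.toReal_div, ENNReal.toReal_one]
    by_cases hp' : p = ∞
    · simp [hp']
    · exact (div_le_one (ENNReal.toReal_pos hp0 hp')).2
        (by simpa using ENNReal.toReal_mono hp' hp)
  by_cases hp' : p = ∞
  · have hq' : q = ∞ := by
      by_contra hq'
      have := toReal_one_div_pos hq0 hq'
      rw [hp', ENNReal.div_top, ENNReal.toReal_zero] at h0
      linarith
    subst hp' hq'
    have hβ' : β = 1 := by rw [hβ]; simp
    simp only [hβ', div_one, ENNReal.rpow_one] at hKr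
    refine ⟨C * ∫⁻ x, resolventMajorant d a c x, ENNReal.mul_ne_top hC hKr.ne, fun f => ?_⟩
    rw [eLpNorm_exponent_top, eLpNorm_exponent_top]
    refine essSup_le_of_ae_le _ (Filter.Eventually.of_forall fun x => (hle f x).trans ?_)
    rw [mul_assoc]
    refine mul_le_mul' le_rfl ?_
    rw [← lintegral_sub_left_eq_self (resolventMajorant d a c) x,
      ← lintegral_mul_const _ (by fun_prop)]
    refine lintegral_mono_ae ?_
    filter_upwards [enorm_ae_le_eLpNormEssSup f volume] with y hy
    gcongr
  have hγ := toReal_one_div_pos hp0 hp'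
  have hfm : ∀ f : 𝓢(EuclideanSpace ℝ (Fin d), ℂ), Measurable fun y => ‖f y‖ₑ := fun f =>
    f.continuous.enorm.measurable
  refine ⟨C * (∫⁻ x, resolventMajorant d a c x ^ (1 / β)) ^ β,
    ENNReal.mul_ne_top hC (ENNReal.rpow_ne_top_of_nonneg hβ0.le hKr.ne), fun f => ?_⟩
  rw [eLpNorm_eq_lintegral_rpow_inv hp0 hp' (f : EuclideanSpace ℝ (Fin d) → ℂ), mul_assoc]
  by_cases hq' : q = ∞
  · subst hq'
    rw [eLpNorm_exponent_top]
    refine essSup_le_of_ae_le _ (Filter.Eventually.of_forall fun x => (hle f x).trans ?_)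
    refine mul_le_mul' le_rfl ?_
    have := conv_le_of_exponents hK (hfm f) le_rfl hβ0.le hγ.le hβ0 hγ (by rw [hβ]; simp) x
    simpa using this
  · have hα := toReal_one_div_pos hq0 hq'
    rw [eLpNorm_eq_lintegral_rpow_inv hq0 hq']
    calc _ ≤ (∫⁻ x, (C * ∫⁻ y, resolventMajorant d a c (x - y) * ‖f y‖ₑ) ^
          (1 / (1 / q).toReal)) ^ (1 / q).toReal := by
          gcongr with x
          exact hle f x
      _ = C * (∫⁻ x, (∫⁻ y, resolventMajorant d a c (x - y) * ‖f y‖ₑ) ^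
          (1 / (1 / q).toReal)) ^ (1 / q).toReal := by
          simp_rw [ENNReal.mul_rpow_of_nonneg _ _ (by positivity : 0 ≤ 1 / (1 / q).toReal)]
          rw [lintegral_const_mul' _ _ (ENNReal.rpow_ne_top_of_nonneg (by positivity) hC),
            ENNReal.mul_rpow_of_nonneg _ _ hα.le, ← ENNReal.rpow_mul,
            one_div_mul_cancel hα.ne', ENNReal.rpow_one]
      _ ≤ _ := by
          gcongr
          exact lintegral_conv_rpow_le hK (hfm f) hα (by rw [hβ]; linarith) h0 (by rw [hβ]; ring)

/-- Bounds for the resolvent on the open Sobolev line `1/p - 1/q = 2/d`, from the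
Hardy–Littlewood–Sobolev inequality. -/
lemma exists_eLpNorm_laplaceResolvent_le_of_eq {z : ℂ}
    (hz : z ∉ (fun t : ℝ => (t : ℂ)) '' Set.Ici 0) (hd : 2 ≤ d) {p q : ℝ≥0∞} (hp : 1 < p)
    (hp' : p ≠ ∞) (hq : 1 ≤ q) (hq' : q ≠ ∞) (h : (1 / p).toReal - (1 / q).toReal = 2 / d) :
    ∃ C : ℝ≥0∞, C ≠ ∞ ∧ ∀ f : 𝓢(EuclideanSpace ℝ (Fin d), ℂ),
      eLpNorm (laplaceResolvent d z f) q volume ≤ C * eLpNorm f p volume := by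
  obtain ⟨a, c, ha, hc, C, hC, hle⟩ := exists_enorm_laplaceResolvent_le (d := d) hz
  have hp0 : p ≠ 0 := (one_pos.trans hp).ne'
  have hq0 : q ≠ 0 := (one_pos.trans_le hq).ne'
  have hpr : 1 < p.toReal := by simpa using (ENNReal.toReal_lt_toReal (by simp) hp').2 hp
  have hpr0 : 0 < p.toReal := by linarith
  have hqr : 0 < q.toReal := ENNReal.toReal_pos hq0 hq'
  simp only [ENNReal.toReal_div, ENNReal.toReal_one] at h
  obtain ⟨C₀, hC₀, hHLS⟩ := exists_lintegral_conv_rpow_le (d := d) ha hc.le hpr hqr (by omega) h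
  refine ⟨C * C₀ ^ (1 / q.toReal),
    ENNReal.mul_ne_top hC (ENNReal.rpow_ne_top_of_nonneg (by positivity) hC₀), fun f => ?_⟩
  have hfm : Measurable fun y => ‖f y‖ₑ := f.continuous.enorm.measurable
  set N : ℝ≥0∞ := eLpNorm f p volume with hN
  have hNeq : N = (∫⁻ y, ‖f y‖ₑ ^ p.toReal) ^ (1 / p.toReal) :=
    eLpNorm_eq_lintegral_rpow_enorm_toReal hp0 hp'
  have hNtop : N ≠ ∞ := (f.memLp p volume).2.ne
  have hconv : (∫⁻ x, (∫⁻ y, resolventMajorant d a c (x - y) * ‖f y‖ₑ) ^ q.toReal) ^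
      (1 / q.toReal) ≤ C₀ ^ (1 / q.toReal) * N := by
    by_cases hN0 : N = 0
    · have hf0 : (fun y => ‖f y‖ₑ) =ᵐ[volume] 0 := by
        have := (eLpNorm_eq_zero_iff f.continuous.aestronglyMeasurable hp0).1 hN0
        filter_upwards [this] with y hy
        simp [hy]
      have : ∀ x, ∫⁻ y, resolventMajorant d a c (x - y) * ‖f y‖ₑ = 0 := by
        intro x
        rw [lintegral_congr_ae (g := fun _ => 0) (by
          filter_upwards [hf0] with y hy
          rw [hy]; simp), lintegral_zero]
      simp [this, hqr]
    · obtain ⟨M, -, hM⟩ := f.decay 0 0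
      simp only [pow_zero, norm_iteratedFDeriv_zero, one_mul] at hM
      have hNi : N⁻¹ ≠ ∞ := ENNReal.inv_ne_top.2 hN0
      have H := hHLS (fun y => N⁻¹ * ‖f y‖ₑ) (hfm.const_mul _) (N⁻¹ * ENNReal.ofReal M)
        (by finiteness) (fun y => by
          gcongr; rw [← ofReal_norm]; exact ENNReal.ofReal_le_ofReal (hM y)) (by
          simp_rw [ENNReal.mul_rpow_of_nonneg _ _ hpr0.le]
          rw [lintegral_const_mul' _ _ (ENNReal.rpow_ne_top_of_nonneg hpr0.le hNi)]
          have e : ∫⁻ y, ‖f y‖ₑ ^ p.toReal = N ^ p.toReal := by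
            rw [hNeq, ← ENNReal.rpow_mul, one_div_mul_cancel hpr0.ne', ENNReal.rpow_one]
          rw [e, ← ENNReal.mul_rpow_of_nonneg _ _ hpr0.le, ENNReal.inv_mul_cancel hN0 hNtop,
            ENNReal.one_rpow])
      have e2 : ∀ x, ∫⁻ y, resolventMajorant d a c (x - y) * ‖f y‖ₑ =
          N * ∫⁻ y, resolventMajorant d a c (x - y) * (N⁻¹ * ‖f y‖ₑ) := by
        intro x
        rw [← lintegral_const_mul' _ _ hNtop]
        refine lintegral_congr fun y => ?_
        rw [mul_left_comm, ← mul_assoc N, ENNReal.mul_inv_cancel hN0 hNtop, one_mul]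
      simp_rw [e2, ENNReal.mul_rpow_of_nonneg _ _ hqr.le]
      rw [lintegral_const_mul' _ _ (ENNReal.rpow_ne_top_of_nonneg hqr.le hNtop),
        ENNReal.mul_rpow_of_nonneg _ _ (by positivity), ← ENNReal.rpow_mul,
        mul_one_div_cancel hqr.ne', ENNReal.rpow_one, mul_comm]
      gcongr
  rw [eLpNorm_eq_lintegral_rpow_enorm_toReal hq0 hq', mul_assoc]
  calc _ ≤ (∫⁻ x, (C * ∫⁻ y, resolventMajorant d a c (x - y) * ‖f y‖ₑ) ^ q.toReal) ^
        (1 / q.toReal) := by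
        gcongr with x
        exact hle f x
    _ = C * (∫⁻ x, (∫⁻ y, resolventMajorant d a c (x - y) * ‖f y‖ₑ) ^ q.toReal) ^
        (1 / q.toReal) := by
        simp_rw [ENNReal.mul_rpow_of_nonneg _ _ hqr.le]
        rw [lintegral_const_mul' _ _ (ENNReal.rpow_ne_top_of_nonneg hqr.le hC),
          ENNReal.mul_rpow_of_nonneg _ _ (by positivity), ← ENNReal.rpow_mul,
          mul_one_div_cancel hqr.ne', ENNReal.rpow_one]
    _ ≤ _ := by gcongr

lemma resolventNorm_lt_top_iff {z : ℂ} {p q : ℝ≥0∞} :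
    resolventNorm d z p q < ∞ ↔ ∃ C : ℝ≥0∞, C ≠ ∞ ∧ ∀ f : 𝓢(EuclideanSpace ℝ (Fin d), ℂ),
      eLpNorm (laplaceResolvent d z f) q volume ≤ C * eLpNorm f p volume := by
  rw [resolventNorm, sInf_lt_iff]
  exact ⟨fun ⟨C, h, hC⟩ => ⟨C, hC.ne, h⟩, fun ⟨C, hC, h⟩ => ⟨C, h, hC.lt_top⟩⟩

/-! ### Dilations and scaling limits of the resolvent -/

lemma exists_schwartz_dilation {r : ℝ} (hr : r ≠ 0) (f : 𝓢(EuclideanSpace ℝ (Fin d), ℂ)) :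
    ∃ g : 𝓢(EuclideanSpace ℝ (Fin d), ℂ), ∀ x, g x = f (r • x) :=
  ⟨SchwartzMap.compCLMOfContinuousLinearEquiv ℂ
    (ContinuousLinearEquiv.smulLeft (R₁ := ℝ) (Units.mk0 r hr)) f, fun _ => rfl⟩

lemma exists_schwartz_of_hasCompactSupport {g : EuclideanSpace ℝ (Fin d) → ℝ}
    (hg : HasCompactSupport g) (hg' : ∀ n : ℕ∞, ContDiff ℝ n g) :
    ∃ f : 𝓢(EuclideanSpace ℝ (Fin d), ℂ), ∀ x, f x = g x := by
  refine ⟨HasCompactSupport.toSchwartzMap (f := fun x => (g x : ℂ))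
    (hg.comp_left (g := fun r : ℝ => (r : ℂ)) (by simp))
    (Complex.ofRealCLM.contDiff.comp (hg' ⊤)), fun _ => rfl⟩

lemma eLpNorm_comp_smul_eq {r : ℝ} (hr : 0 < r) (g : EuclideanSpace ℝ (Fin d) → ℂ) (p : ℝ≥0∞) :
    eLpNorm (fun x => g (r • x)) p volume =
      ENNReal.ofReal (r ^ (-((d : ℝ) * (1 / p).toReal))) * eLpNorm g p volume := by
  have hemb : MeasurableEmbedding (fun x : EuclideanSpace ℝ (Fin d) => r • x) :=
    (Homeomorph.smulOfNeZero r hr.ne').measurableEmbedding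
  have h := hemb.eLpNorm_map_measure (g := g) (p := p) (μ := volume)
  rw [Measure.map_addHaar_smul volume hr.ne', eLpNorm_smul_measure_of_ne_zero (by
    rw [Ne, ENNReal.ofReal_eq_zero, not_le]; positivity)] at h
  rw [show (fun x => g (r • x)) = g ∘ fun x => r • x from rfl, ← h, smul_eq_mul]
  congr 1
  rw [finrank_euclideanSpace, Fintype.card_fin, abs_of_pos (by positivity),
    ENNReal.ofReal_rpow_of_pos (by positivity), ← Real.rpow_natCast, ← Real.rpow_neg hr.le,
    ← Real.rpow_mul hr.le]
  congr 2
  ring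

/-- Dilations intertwine the resolvents at `z` and at `r⁻² z`. -/
lemma laplaceResolvent_dilation {r : ℝ} (hr : 0 < r) (z : ℂ)
    {f g : 𝓢(EuclideanSpace ℝ (Fin d), ℂ)} (hfg : ∀ x, g x = f (r • x))
    (x : EuclideanSpace ℝ (Fin d)) :
    laplaceResolvent d z g x = (((r ^ 2)⁻¹ : ℝ) : ℂ) *
      laplaceResolvent d ((((r ^ 2)⁻¹ : ℝ) : ℂ) * z) f (r • x) := by
  have hF : ∀ ξ, 𝓕 g ξ = (((r ^ d)⁻¹ : ℝ) : ℂ) * 𝓕 f (r⁻¹ • ξ) := by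
    intro ξ
    have := Measure.integral_comp_smul (volume : Measure (EuclideanSpace ℝ (Fin d)))
      (fun u => Complex.exp ((↑(-2 * Real.pi * inner ℝ u (r⁻¹ • ξ)) * Complex.I)) • f u) r
    rw [SchwartzMap.fourier_coe, SchwartzMap.fourier_coe, Real.fourier_eq', Real.fourier_eq']
    rw [finrank_euclideanSpace, Fintype.card_fin, abs_of_pos (by positivity)] at this
    rw [← Complex.real_smul, ← this]
    refine integral_congr_ae (Filter.Eventually.of_forall fun v => ?_)
    simp only [hfg, inner_smul_left, inner_smul_right]
    congr 5
    simp only [conj_trivial]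
    field_simp
  rw [laplaceResolvent_apply, laplaceResolvent_apply]
  have hout := Measure.integral_comp_smul (volume : Measure (EuclideanSpace ℝ (Fin d)))
    (fun η => Complex.exp (2 * Real.pi * Complex.I * (inner ℝ (r • x) η : ℝ)) *
      ((laplaceSymbol d ((((r ^ 2)⁻¹ : ℝ) : ℂ) * z) η)⁻¹ * 𝓕 f η)) r⁻¹
  rw [finrank_euclideanSpace, Fintype.card_fin, abs_of_pos (by positivity), inv_pow,
    inv_inv] at hout
  have hout' : ∫ η, Complex.exp (2 * Real.pi * Complex.I * (inner ℝ (r • x) η : ℝ)) *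
      ((laplaceSymbol d ((((r ^ 2)⁻¹ : ℝ) : ℂ) * z) η)⁻¹ * 𝓕 f η) =
      (((r ^ d)⁻¹ : ℝ) : ℂ) * ∫ ξ, Complex.exp (2 * Real.pi * Complex.I *
        (inner ℝ (r • x) (r⁻¹ • ξ) : ℝ)) *
        ((laplaceSymbol d ((((r ^ 2)⁻¹ : ℝ) : ℂ) * z) (r⁻¹ • ξ))⁻¹ * 𝓕 f (r⁻¹ • ξ)) := by
    rw [hout, Complex.real_smul, ← mul_assoc, ← Complex.ofReal_mul,
      inv_mul_cancel₀ (by positivity), Complex.ofReal_one, one_mul]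
  rw [hout', ← mul_assoc, ← integral_const_mul]
  refine integral_congr_ae (Filter.Eventually.of_forall fun ξ => ?_)
  have hr' : (r : ℂ) ≠ 0 := by exact_mod_cast hr.ne'
  have hsym : laplaceSymbol d ((((r ^ 2)⁻¹ : ℝ) : ℂ) * z) (r⁻¹ • ξ) =
      (((r ^ 2)⁻¹ : ℝ) : ℂ) * laplaceSymbol d z ξ := by
    simp only [laplaceSymbol, norm_smul, norm_inv, Real.norm_eq_abs, abs_of_pos hr]
    push_cast
    field_simp
  have hinner : (inner ℝ (r • x) (r⁻¹ • ξ) : ℝ) = inner ℝ x ξ := by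
    rw [inner_smul_left, inner_smul_right]
    simp only [conj_trivial]
    field_simp
  simp only
  rw [hF, hsym, hinner, mul_inv]
  push_cast
  field_simp

lemma aestronglyMeasurable_laplaceResolvent (z : ℂ) (f : 𝓢(EuclideanSpace ℝ (Fin d), ℂ)) :
    AEStronglyMeasurable (laplaceResolvent d z f) volume := by
  have h : laplaceResolvent d z f = fun x => ∫ ξ, Complex.exp (2 * Real.pi * Complex.I *
      (inner ℝ x ξ : ℝ)) * ((laplaceSymbol d z ξ)⁻¹ * 𝓕 f ξ) :=
    funext (laplaceResolvent_apply z f)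
  rw [h]
  have h1 : Measurable (laplaceSymbol d z) := (continuous_laplaceSymbol z).measurable
  have h2 : Measurable fun ξ => 𝓕 f ξ := (𝓕 f).continuous.measurable
  have h3 : Measurable fun q : EuclideanSpace ℝ (Fin d) × EuclideanSpace ℝ (Fin d) =>
      Complex.exp (2 * Real.pi * Complex.I * (inner ℝ q.1 q.2 : ℝ)) *
        ((laplaceSymbol d z q.2)⁻¹ * 𝓕 f q.2) := by fun_prop
  exact (h3.stronglyMeasurable.integral_prod_right').aestronglyMeasurable

lemma continuous_laplaceResolvent {z : ℂ} {f : 𝓢(EuclideanSpace ℝ (Fin d), ℂ)}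
    (h : Integrable fun ξ => (laplaceSymbol d z ξ)⁻¹ * 𝓕 f ξ) :
    Continuous (laplaceResolvent d z f) :=
  VectorFourier.fourierIntegral_continuous (L := -innerₗ (EuclideanSpace ℝ (Fin d)))
    Real.continuous_fourierChar (by
      change Continuous fun p : EuclideanSpace ℝ (Fin d) × EuclideanSpace ℝ (Fin d) =>
        -(inner ℝ p.1 p.2 : ℝ)
      fun_prop) h

lemma enorm_le_eLpNorm_top_of_continuous {g : EuclideanSpace ℝ (Fin d) → ℂ} (hg : Continuous g)
    (x : EuclideanSpace ℝ (Fin d)) : ‖g x‖ₑ ≤ eLpNorm g ∞ volume := by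
  have hclosed : IsClosed {y | ‖g y‖ₑ ≤ eLpNorm g ∞ volume} :=
    isClosed_le hg.enorm continuous_const
  have hdense : Dense {y | ‖g y‖ₑ ≤ eLpNorm g ∞ volume} := by
    refine Measure.dense_of_ae (μ := volume) ?_
    rw [eLpNorm_exponent_top]
    exact enorm_ae_le_eLpNormEssSup g volume
  have := hclosed.closure_eq ▸ hdense.closure_eq
  exact (Set.eq_univ_iff_forall.1 this) x

/-- A lower bound for `|s - ε z|` that is homogeneous in `(s, ε)`: `z` stays away from the
positive half line also after scaling. -/
lemma exists_le_norm_sub {z : ℂ} (hz : z ∉ (fun t : ℝ => (t : ℂ)) '' Set.Ici 0) :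
    ∃ κ : ℝ, 0 < κ ∧ ∀ s ε : ℝ, 0 ≤ s → 0 ≤ ε → κ * (s + ε) ≤ ‖(s : ℂ) - ε * z‖ := by
  obtain ⟨w, hw, hwz⟩ := exists_rotation hz
  have hw0 : 0 < ‖w‖ := norm_pos_iff.2 (by rintro rfl; simp at hw)
  refine ⟨min w.re (-(w * z)).re / ‖w‖, div_pos (lt_min hw hwz) hw0, fun s ε hs hε => ?_⟩
  rw [div_mul_eq_mul_div, div_le_iff₀ hw0, mul_comm ‖_‖, ← norm_mul]
  refine le_trans ?_ (Complex.re_le_norm _)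
  have e : (w * ((s : ℂ) - ε * z)).re = w.re * s + ε * (-(w * z)).re := by
    rw [mul_sub, Complex.sub_re, Complex.re_mul_ofReal, mul_left_comm, Complex.re_ofReal_mul,
      Complex.neg_re]
    ring
  rw [e, mul_add, mul_comm ε]
  have h1 := min_le_left w.re (-(w * z)).re
  have h2 := min_le_right w.re (-(w * z)).re
  gcongr

lemma norm_exp_inner (x ξ : EuclideanSpace ℝ (Fin d)) :
    ‖Complex.exp (2 * Real.pi * Complex.I * (inner ℝ x ξ : ℝ))‖ = 1 := by
  rw [Complex.norm_exp, show (2 * Real.pi * Complex.I * (inner ℝ x ξ : ℝ) : ℂ).re = 0 by simp,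
    Real.exp_zero]

/-- As `r → 0`, `r⁻² (-Δ - r⁻² z)⁻¹` tends to multiplication by `-z⁻¹`. -/
lemma tendsto_laplaceResolvent_of_tendsto_zero {z : ℂ}
    (hz : z ∉ (fun t : ℝ => (t : ℂ)) '' Set.Ici 0) (f : 𝓢(EuclideanSpace ℝ (Fin d), ℂ))
    (x : EuclideanSpace ℝ (Fin d)) {r : ℕ → ℝ} (hr : ∀ n, 0 < r n)
    (hr0 : Filter.Tendsto r Filter.atTop (nhds 0)) :
    Filter.Tendsto (fun n => ((((r n) ^ 2)⁻¹ : ℝ) : ℂ) *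
      laplaceResolvent d (((((r n) ^ 2)⁻¹ : ℝ) : ℂ) * z) f x) Filter.atTop
      (nhds (-z⁻¹ * f x)) := by
  obtain ⟨κ, hκ, hle⟩ := exists_le_norm_sub hz
  have hz0 : z ≠ 0 := by rintro rfl; exact hz ⟨0, by simp, by simp⟩
  have heq : ∀ n, ((((r n) ^ 2)⁻¹ : ℝ) : ℂ) *
      laplaceResolvent d (((((r n) ^ 2)⁻¹ : ℝ) : ℂ) * z) f x =
      ∫ ξ, Complex.exp (2 * Real.pi * Complex.I * (inner ℝ x ξ : ℝ)) *
        (((((r n) ^ 2 * (2 * Real.pi * ‖ξ‖) ^ 2 : ℝ) : ℂ) - z)⁻¹ * 𝓕 f ξ) := by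
    intro n
    rw [laplaceResolvent_apply, ← integral_const_mul]
    refine integral_congr_ae (Filter.Eventually.of_forall fun ξ => ?_)
    have hrn : ((r n : ℝ) : ℂ) ≠ 0 := by exact_mod_cast (hr n).ne'
    have e : ((((r n) ^ 2 * (2 * Real.pi * ‖ξ‖) ^ 2 : ℝ) : ℂ) - z) =
        (((r n) ^ 2 : ℝ) : ℂ) * laplaceSymbol d (((((r n) ^ 2)⁻¹ : ℝ) : ℂ) * z) ξ := by
      rw [laplaceSymbol]; push_cast; field_simp
    simp only [e, mul_inv]
    push_cast; ring
  have hlim : -z⁻¹ * f x = ∫ ξ, Complex.exp (2 * Real.pi * Complex.I * (inner ℝ x ξ : ℝ)) *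
      (((((0 : ℝ) ^ 2 * (2 * Real.pi * ‖ξ‖) ^ 2 : ℝ) : ℂ) - z)⁻¹ * 𝓕 f ξ) := by
    have hinv : f x = 𝓕⁻ (𝓕 f) x := by rw [FourierTransform.fourierInv_fourier_eq]
    rw [hinv, SchwartzMap.fourierInv_coe, Real.fourierInv_eq', ← integral_const_mul]
    refine integral_congr_ae (Filter.Eventually.of_forall fun ξ => ?_)
    simp only [smul_eq_mul, real_inner_comm x ξ]
    have e : (2 * Real.pi * Complex.I * (inner ℝ x ξ : ℝ) : ℂ) =
      ((2 * Real.pi * inner ℝ x ξ : ℝ) : ℂ) * Complex.I := by push_cast; ring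
    rw [e]
    simp [inv_neg]
    ring
  simp_rw [heq]
  rw [hlim]
  refine tendsto_integral_of_dominated_convergence (fun ξ => κ⁻¹ * ‖𝓕 f ξ‖) (fun n => ?_)
    ((𝓕 f).integrable.norm.const_mul _) (fun n => Filter.Eventually.of_forall fun ξ => ?_)
    (Filter.Eventually.of_forall fun ξ => ?_)
  · have h2 : Measurable fun ξ => 𝓕 f ξ := (𝓕 f).continuous.measurable
    exact Measurable.aestronglyMeasurable (by fun_prop)
  · rw [norm_mul, norm_exp_inner, one_mul, norm_mul, norm_inv]
    gcongr
    have := hle ((r n) ^ 2 * (2 * Real.pi * ‖ξ‖) ^ 2) 1 (by positivity) zero_le_one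
    rw [Complex.ofReal_one, one_mul] at this
    refine le_trans ?_ this
    have h0 : 0 ≤ (r n) ^ 2 * (2 * Real.pi * ‖ξ‖) ^ 2 := by positivity
    nlinarith
  · have hc : Filter.Tendsto (fun n => ((((r n) ^ 2 * (2 * Real.pi * ‖ξ‖) ^ 2 : ℝ) : ℂ) - z))
        Filter.atTop (nhds ((((0 : ℝ) ^ 2 * (2 * Real.pi * ‖ξ‖) ^ 2 : ℝ) : ℂ) - z)) :=
      ((Complex.continuous_ofReal.tendsto _).comp ((hr0.pow 2).mul_const _)).sub_const z
    exact ((hc.inv₀ (by simpa using hz0)).mul_const _).const_mul _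

/-- In dimension at least three, `(-Δ - ε z)⁻¹` tends to `(-Δ)⁻¹` as `ε → 0`. -/
lemma tendsto_laplaceResolvent_zero {z : ℂ} (hd : 3 ≤ d)
    (hz : z ∉ (fun t : ℝ => (t : ℂ)) '' Set.Ici 0) (f : 𝓢(EuclideanSpace ℝ (Fin d), ℂ))
    (x : EuclideanSpace ℝ (Fin d)) {ε : ℕ → ℝ} (hε : ∀ n, 0 ≤ ε n)
    (hε0 : Filter.Tendsto ε Filter.atTop (nhds 0)) :
    Filter.Tendsto (fun n => laplaceResolvent d ((ε n : ℂ) * z) f x) Filter.atTop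
      (nhds (laplaceResolvent d 0 f x)) := by
  obtain ⟨κ, hκ, hle⟩ := exists_le_norm_sub hz
  have : Nonempty (Fin d) := ⟨⟨0, by omega⟩⟩
  have hne : ∀ᵐ ξ : EuclideanSpace ℝ (Fin d), ξ ≠ 0 := Measure.ae_ne volume 0
  simp_rw [laplaceResolvent_apply]
  refine tendsto_integral_of_dominated_convergence
    (fun ξ => (κ * (2 * Real.pi) ^ 2)⁻¹ * ((‖ξ‖ ^ 2)⁻¹ * ‖𝓕 f ξ‖)) (fun n => ?_)
    ((integrable_inv_sq_norm_mul hd (𝓕 f)).const_mul _) (fun n => ?_) ?_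
  · have h1 : Measurable (laplaceSymbol d ((ε n : ℂ) * z)) := (continuous_laplaceSymbol _).measurable
    have h2 : Measurable fun ξ => 𝓕 f ξ := (𝓕 f).continuous.measurable
    exact Measurable.aestronglyMeasurable (by fun_prop)
  · filter_upwards [hne] with ξ hξ
    have hξ' := norm_pos_iff.2 hξ
    rw [norm_mul, norm_exp_inner, one_mul, norm_mul, norm_inv, ← mul_assoc, ← mul_inv]
    gcongr
    have := hle ((2 * Real.pi * ‖ξ‖) ^ 2) (ε n) (by positivity) (hε n)
    refine le_trans ?_ this
    have h0 : 0 ≤ κ * ε n := mul_nonneg hκ.le (hε n)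
    nlinarith
  · filter_upwards [hne] with ξ hξ
    have hξ' := norm_pos_iff.2 hξ
    have hc : Filter.Tendsto (fun n => laplaceSymbol d ((ε n : ℂ) * z) ξ) Filter.atTop
        (nhds (laplaceSymbol d 0 ξ)) := by
      have := ((Complex.continuous_ofReal.tendsto _).comp hε0).mul_const z
      simp only [laplaceSymbol]
      refine Filter.Tendsto.const_sub _ ?_
      simpa using this
    refine ((hc.inv₀ ?_).mul_const _).const_mul _
    rw [laplaceSymbol, sub_zero]
    exact_mod_cast (by positivity : (2 * Real.pi * ‖ξ‖) ^ 2 ≠ 0)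

/-- An `L^p → L^q` bound at `z`, rescaled. -/
lemma eLpNorm_laplaceResolvent_rescaled {z : ℂ} {p q C : ℝ≥0∞}
    (hC : ∀ f : 𝓢(EuclideanSpace ℝ (Fin d), ℂ),
      eLpNorm (laplaceResolvent d z f) q volume ≤ C * eLpNorm f p volume)
    (f : 𝓢(EuclideanSpace ℝ (Fin d), ℂ)) {r : ℝ} (hr : 0 < r) :
    eLpNorm (fun x => (((r ^ 2)⁻¹ : ℝ) : ℂ) *
      laplaceResolvent d ((((r ^ 2)⁻¹ : ℝ) : ℂ) * z) f x) q volume ≤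
      ENNReal.ofReal (r ^ ((d : ℝ) * ((1 / q).toReal - (1 / p).toReal))) *
        (C * eLpNorm f p volume) := by
  obtain ⟨g, hg⟩ := exists_schwartz_dilation hr.ne' f
  have h := hC g
  have e1 : laplaceResolvent d z g = fun x => (fun x => (((r ^ 2)⁻¹ : ℝ) : ℂ) *
      laplaceResolvent d ((((r ^ 2)⁻¹ : ℝ) : ℂ) * z) f x) (r • x) :=
    funext fun x => laplaceResolvent_dilation hr z hg x
  have e2 : (g : EuclideanSpace ℝ (Fin d) → ℂ) = fun x => f (r • x) := funext hg
  rw [e1, e2, eLpNorm_comp_smul_eq hr, eLpNorm_comp_smul_eq hr (fun x => (((r ^ 2)⁻¹ : ℝ) : ℂ) *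
      laplaceResolvent d ((((r ^ 2)⁻¹ : ℝ) : ℂ) * z) f x)] at h
  have h' := mul_le_mul_right h (ENNReal.ofReal (r ^ ((d : ℝ) * (1 / q).toReal)))
  rw [← mul_assoc, ← ENNReal.ofReal_mul (by positivity), ← Real.rpow_add hr, add_neg_cancel,
    Real.rpow_zero, ENNReal.ofReal_one, one_mul] at h'
  refine h'.trans (le_of_eq ?_)
  rw [mul_left_comm C, ← mul_assoc, ← ENNReal.ofReal_mul (by positivity), ← Real.rpow_add hr]
  congr 3
  ring

/-- The same bound with the factor `r⁻²` moved to the right. -/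
lemma eLpNorm_laplaceResolvent_rescaled' {z : ℂ} {p q C : ℝ≥0∞}
    (hC : ∀ f : 𝓢(EuclideanSpace ℝ (Fin d), ℂ),
      eLpNorm (laplaceResolvent d z f) q volume ≤ C * eLpNorm f p volume)
    (f : 𝓢(EuclideanSpace ℝ (Fin d), ℂ)) {r : ℝ} (hr : 0 < r) :
    eLpNorm (laplaceResolvent d ((((r ^ 2)⁻¹ : ℝ) : ℂ) * z) f) q volume ≤
      ENNReal.ofReal (r ^ (2 - (d : ℝ) * ((1 / p).toReal - (1 / q).toReal))) *
        (C * eLpNorm f p volume) := by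
  have h := eLpNorm_laplaceResolvent_rescaled hC f hr
  have e := eLpNorm_const_smul (μ := volume) (p := q) (((r ^ 2)⁻¹ : ℝ) : ℂ)
    (laplaceResolvent d ((((r ^ 2)⁻¹ : ℝ) : ℂ) * z) f)
  have e' : eLpNorm (fun x => (((r ^ 2)⁻¹ : ℝ) : ℂ) *
      laplaceResolvent d ((((r ^ 2)⁻¹ : ℝ) : ℂ) * z) f x) q volume = ENNReal.ofReal (r ^ 2)⁻¹ *
      eLpNorm (laplaceResolvent d ((((r ^ 2)⁻¹ : ℝ) : ℂ) * z) f) q volume := by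
    rw [← ofReal_norm, Complex.norm_real, Real.norm_eq_abs, abs_of_pos (by positivity)] at e
    exact e
  rw [e'] at h
  have h' := mul_le_mul_right h (ENNReal.ofReal (r ^ 2))
  rw [← mul_assoc, ← ENNReal.ofReal_mul (by positivity), mul_inv_cancel₀ (by positivity),
    ENNReal.ofReal_one, one_mul] at h'
  refine h'.trans (le_of_eq ?_)
  rw [← mul_assoc, ← ENNReal.ofReal_mul (by positivity), ← Real.rpow_two, ← Real.rpow_add hr]
  congr 3
  ring

/-! ### Unboundedness outside the region -/

lemma exists_schwartz_bump (d : ℕ) : ∃ (f : 𝓢(EuclideanSpace ℝ (Fin d), ℂ))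
    (g : EuclideanSpace ℝ (Fin d) → ℝ), (∀ x, 0 ≤ g x) ∧ (∀ x, ‖x‖ ≤ 1 → g x = 1) ∧
      ∀ x, f x = g x := by
  let b : ContDiffBump (0 : EuclideanSpace ℝ (Fin d)) := ⟨1, 2, one_pos, one_lt_two⟩
  obtain ⟨f, hf⟩ := exists_schwartz_of_hasCompactSupport b.hasCompactSupport fun n => b.contDiff
  exact ⟨f, b, fun x => b.nonneg, fun x hx => b.one_of_mem_closedBall (by simpa using hx), hf⟩

lemma eLpNorm_le_of_tendsto {F : ℕ → EuclideanSpace ℝ (Fin d) → ℂ}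
    {G : EuclideanSpace ℝ (Fin d) → ℂ} {q K : ℝ≥0∞} {u : ℕ → ℝ} {L : ℝ} (hK : K ≠ ∞)
    (hF : ∀ n, AEStronglyMeasurable (F n) volume)
    (hlim : ∀ x, Filter.Tendsto (fun n => F n x) Filter.atTop (nhds (G x)))
    (hu : Filter.Tendsto u Filter.atTop (nhds L))
    (hle : ∀ n, eLpNorm (F n) q volume ≤ ENNReal.ofReal (u n) * K) :
    eLpNorm G q volume ≤ ENNReal.ofReal L * K := by
  refine (Lp.eLpNorm_lim_le_liminf_eLpNorm hF G (Filter.Eventually.of_forall hlim)).trans ?_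
  refine (Filter.liminf_le_liminf (Filter.Eventually.of_forall hle)).trans (le_of_eq ?_)
  exact (ENNReal.Tendsto.mul_const (ENNReal.tendsto_ofReal hu) (Or.inr hK)).liminf_eq

lemma tendsto_natCast_add_one_rpow_neg {e : ℝ} (he : 0 < e) :
    Filter.Tendsto (fun n : ℕ => ((n : ℝ) + 1) ^ (-e)) Filter.atTop (nhds 0) :=
  (tendsto_rpow_neg_atTop he).comp
    (Filter.tendsto_atTop_add_const_right _ 1 tendsto_natCast_atTop_atTop)

/-- A bound forces `p ≤ q`: on ever wider dilates of a bump the resolvent acts in the limit as the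
scalar `-z⁻¹`, so that a bound with `q < p` would survive with constant zero. -/
lemma toReal_one_div_le_of_bound {z : ℂ} (hd : 0 < d)
    (hz : z ∉ (fun t : ℝ => (t : ℂ)) '' Set.Ici 0) {p q C : ℝ≥0∞} (hq : q ≠ 0) (hCtop : C ≠ ∞)
    (hC : ∀ f : 𝓢(EuclideanSpace ℝ (Fin d), ℂ),
      eLpNorm (laplaceResolvent d z f) q volume ≤ C * eLpNorm f p volume) :
    (1 / q).toReal ≤ (1 / p).toReal := by
  by_contra! hlt
  obtain ⟨f, g, -, hg1, hfg⟩ := exists_schwartz_bump d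
  have hd' : (0 : ℝ) < d := by exact_mod_cast hd
  have hz0 : z ≠ 0 := by rintro rfl; exact hz ⟨0, by simp, by simp⟩
  have hr : ∀ n : ℕ, 0 < ((n : ℝ) + 1)⁻¹ := fun n => by positivity
  have hr0 : Filter.Tendsto (fun n : ℕ => ((n : ℝ) + 1)⁻¹) Filter.atTop (nhds 0) := by
    simpa using tendsto_one_div_add_atTop_nhds_zero_nat (𝕜 := ℝ)
  set e : ℝ := (d : ℝ) * ((1 / q).toReal - (1 / p).toReal) with he
  have he0 : 0 < e := mul_pos hd' (by linarith)
  have hu : Filter.Tendsto (fun n : ℕ => (((n : ℝ) + 1)⁻¹) ^ e) Filter.atTop (nhds 0) := by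
    refine (tendsto_natCast_add_one_rpow_neg he0).congr fun n => ?_
    rw [Real.inv_rpow (by positivity), Real.rpow_neg (by positivity)]
  have h := eLpNorm_le_of_tendsto (q := q) (K := C * eLpNorm f p volume)
    (ENNReal.mul_ne_top hCtop (f.memLp p volume).2.ne)
    (fun n => (aestronglyMeasurable_laplaceResolvent _ f).const_mul _)
    (fun x => tendsto_laplaceResolvent_of_tendsto_zero hz f x hr hr0) hu
    (fun n => eLpNorm_laplaceResolvent_rescaled hC f (hr n))
  rw [ENNReal.ofReal_zero, zero_mul, nonpos_iff_eq_zero, eLpNorm_eq_zero_iff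
    (f.continuous.aestronglyMeasurable.const_mul _) hq] at h
  have h2 := (Continuous.ae_eq_iff_eq volume (continuous_const.mul f.continuous)
    (continuous_const (y := (0 : ℂ)))).1 h
  have h3 := congrFun h2 0
  simp [hfg, hg1, hz0] at h3

/-- Concentrating functions at a point turns a bound at `z` on or beyond the Sobolev line into a
bound at `0`. -/
lemma eLpNorm_laplaceResolvent_zero_le {z : ℂ} (hd : 3 ≤ d)
    (hz : z ∉ (fun t : ℝ => (t : ℂ)) '' Set.Ici 0) {p q C : ℝ≥0∞} (hCtop : C ≠ ∞)
    (hC : ∀ f : 𝓢(EuclideanSpace ℝ (Fin d), ℂ),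
      eLpNorm (laplaceResolvent d z f) q volume ≤ C * eLpNorm f p volume) {L : ℝ}
    (hL : Filter.Tendsto (fun n : ℕ => ((n : ℝ) + 1) ^
      (2 - (d : ℝ) * ((1 / p).toReal - (1 / q).toReal))) Filter.atTop (nhds L))
    (f : 𝓢(EuclideanSpace ℝ (Fin d), ℂ)) :
    eLpNorm (laplaceResolvent d 0 f) q volume ≤ ENNReal.ofReal L * (C * eLpNorm f p volume) := by
  have hε0 : Filter.Tendsto (fun n : ℕ => (((n : ℝ) + 1) ^ 2)⁻¹) Filter.atTop (nhds 0) := by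
    have := (tendsto_one_div_add_atTop_nhds_zero_nat (𝕜 := ℝ)).pow 2
    simpa using this
  exact eLpNorm_le_of_tendsto (ENNReal.mul_ne_top hCtop (f.memLp p volume).2.ne)
    (fun n => aestronglyMeasurable_laplaceResolvent _ f)
    (fun x => tendsto_laplaceResolvent_zero hd hz f x (fun n => by positivity) hε0) hL
    (fun n => eLpNorm_laplaceResolvent_rescaled' hC f (by positivity))

/-- `(-Δ)⁻¹` of a bump decays no faster than the fundamental solution. -/
lemma exists_le_enorm_laplaceResolvent_zero_bump (hd : 3 ≤ d) :
    ∃ (f : 𝓢(EuclideanSpace ℝ (Fin d), ℂ)) (c : ℝ≥0∞), c ≠ 0 ∧ ∀ x,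
      c * ENNReal.ofReal ((1 + ‖x‖ ^ 2) ^ (1 - (d : ℝ) / 2)) ≤ ‖laplaceResolvent d 0 f x‖ₑ := by
  obtain ⟨κ, hκ, hle⟩ := exists_le_enorm_laplaceResolvent_zero hd
  obtain ⟨f, g, hg0, hg1, hfg⟩ := exists_schwartz_bump d
  have hd3 : (3 : ℝ) ≤ d := by exact_mod_cast hd
  refine ⟨f, ENNReal.ofReal κ * (ENNReal.ofReal (4 ^ (1 - (d : ℝ) / 2)) *
    volume (Metric.ball (0 : EuclideanSpace ℝ (Fin d)) 1)), ?_, fun x => ?_⟩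
  · refine mul_ne_zero (by simpa using hκ) (mul_ne_zero ?_ ?_)
    · rw [Ne, ENNReal.ofReal_eq_zero, not_le]; positivity
    · exact (Metric.measure_ball_pos _ _ one_pos).ne'
  refine le_trans ?_ (hle f g hg0 hfg x)
  rw [mul_assoc]
  refine mul_le_mul' le_rfl ?_
  calc _ = ∫⁻ _ in Metric.ball (0 : EuclideanSpace ℝ (Fin d)) 1,
        ENNReal.ofReal ((4 * (1 + ‖x‖ ^ 2)) ^ (1 - (d : ℝ) / 2)) := by
        rw [setLIntegral_const, Real.mul_rpow (by norm_num) (by positivity),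
          ENNReal.ofReal_mul (by positivity)]
        ring
    _ ≤ ∫⁻ y in Metric.ball (0 : EuclideanSpace ℝ (Fin d)) 1,
        ENNReal.ofReal ((1 + ‖x - y‖ ^ 2) ^ (1 - (d : ℝ) / 2) * g y) := by
        refine setLIntegral_mono_ae' measurableSet_ball (Filter.Eventually.of_forall fun y hy => ?_)
        have hy1 : ‖y‖ ≤ 1 := (by simpa using hy : ‖y‖ < 1).le
        rw [hg1 y hy1, mul_one]
        refine ENNReal.ofReal_le_ofReal (Real.rpow_le_rpow_of_nonpos (by positivity) ?_ (by linarith))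
        have h1 := norm_sub_le x y
        nlinarith [norm_nonneg (x - y), norm_nonneg x, norm_nonneg y, sq_nonneg (‖x‖ - 1),
          mul_self_le_mul_self (norm_nonneg (x - y)) h1]
    _ ≤ _ := setLIntegral_le_lintegral _ _

lemma lintegral_one_add_sq_norm_rpow_eq_top (hd : 0 < d) :
    ∫⁻ x : EuclideanSpace ℝ (Fin d), ENNReal.ofReal ((1 + ‖x‖ ^ 2) ^ (-((d : ℝ) / 2))) = ∞ := by
  have : Nonempty (Fin d) := ⟨⟨0, hd⟩⟩
  by_contra h
  have hint : Integrable fun x : EuclideanSpace ℝ (Fin d) =>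
      (1 + ‖x‖ ^ 2) ^ (-((d : ℝ) / 2)) :=
    (lintegral_ofReal_ne_top_iff_integrable (Measurable.aestronglyMeasurable (by fun_prop))
      (Filter.Eventually.of_forall fun x => by positivity)).1 h
  rw [integrable_fun_norm_addHaar volume (f := fun r : ℝ => (1 + r ^ 2) ^ (-((d : ℝ) / 2)))] at hint
  refine not_integrableOn_Ioi_inv (a := 1) ?_
  have h2 : IntegrableOn (fun y : ℝ => (2 : ℝ) ^ ((d : ℝ) / 2) * (y ^
      (Module.finrank ℝ (EuclideanSpace ℝ (Fin d)) - 1) • (1 + y ^ 2) ^ (-((d : ℝ) / 2))))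
      (Set.Ioi 1) :=
    (hint.mono_set (Set.Ioi_subset_Ioi zero_le_one)).const_mul _
  refine Integrable.mono' h2 (Measurable.aestronglyMeasurable (by fun_prop))
    ((ae_restrict_iff' measurableSet_Ioi).2 (Filter.Eventually.of_forall fun y hy => ?_))
  have hy : 1 < y := hy
  have hy0 : 0 < y := by linarith
  rw [Real.norm_eq_abs, abs_of_pos (by positivity), finrank_euclideanSpace, Fintype.card_fin,
    smul_eq_mul]
  have h3 : (2 * y ^ 2) ^ (-((d : ℝ) / 2)) ≤ (1 + y ^ 2) ^ (-((d : ℝ) / 2)) :=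
    Real.rpow_le_rpow_of_nonpos (by positivity) (by nlinarith) (by
      have : (0 : ℝ) ≤ d := by positivity
      linarith)
  calc y⁻¹ = (2 : ℝ) ^ ((d : ℝ) / 2) * (y ^ (d - 1) * (2 * y ^ 2) ^ (-((d : ℝ) / 2))) := by
        rw [Real.mul_rpow (by norm_num) (by positivity), ← Real.rpow_natCast y 2,
          ← Real.rpow_mul hy0.le, ← Real.rpow_natCast y (d - 1), Nat.cast_sub hd, mul_left_comm,
          ← mul_assoc (2 ^ _ : ℝ), mul_comm (2 ^ _ : ℝ), Real.rpow_neg (by norm_num),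
          inv_mul_cancel₀ (by positivity), mul_comm, one_mul, ← Real.rpow_add hy0,
          ← Real.rpow_neg_one]
        congr 1
        push_cast; ring
    _ ≤ _ := by gcongr

/-- On the Sobolev line the endpoint `1/q = (d-2)/d` fails: `(-Δ)⁻¹` of a bump decays like
`|x|^{2-d}`, which just misses `L^{d/(d-2)}`. -/
lemma eLpNorm_laplaceResolvent_zero_bump_eq_top (hd : 3 ≤ d) {q : ℝ≥0∞} (hq : q ≠ 0)
    (hq' : (1 / q).toReal = ((d : ℝ) - 2) / d) :
    ∃ f : 𝓢(EuclideanSpace ℝ (Fin d), ℂ), eLpNorm (laplaceResolvent d 0 f) q volume = ∞ := by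
  obtain ⟨f, c, hc, hle⟩ := exists_le_enorm_laplaceResolvent_zero_bump hd
  have hd3 : (3 : ℝ) ≤ d := by exact_mod_cast hd
  have hd2 : (d : ℝ) - 2 ≠ 0 := by linarith
  have hpos : 0 < ((d : ℝ) - 2) / d := div_pos (by linarith) (by linarith)
  have hqtop : q ≠ ∞ := by
    rintro rfl
    simp at hq'
    rw [← hq'] at hpos
    exact lt_irrefl _ hpos
  refine ⟨f, ?_⟩
  rw [eLpNorm_eq_lintegral_rpow_inv hq hqtop, hq', ENNReal.rpow_eq_top_iff_of_pos hpos,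
    eq_top_iff]
  calc (∞ : ℝ≥0∞) = c ^ (1 / (((d : ℝ) - 2) / d)) * ∫⁻ x : EuclideanSpace ℝ (Fin d),
        ENNReal.ofReal ((1 + ‖x‖ ^ 2) ^ (-((d : ℝ) / 2))) := by
        rw [lintegral_one_add_sq_norm_rpow_eq_top (by omega), ENNReal.mul_top]
        rw [Ne, ENNReal.rpow_eq_zero_iff]
        have : 0 < 1 / (((d : ℝ) - 2) / d) := by positivity
        rintro (h | h)
        · exact hc h.1
        · linarith [h.2]
    _ ≤ ∫⁻ x, (c * ENNReal.ofReal ((1 + ‖x‖ ^ 2) ^ (1 - (d : ℝ) / 2))) ^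
          (1 / (((d : ℝ) - 2) / d)) := by
        rw [← lintegral_const_mul _ (by fun_prop)]
        refine lintegral_mono fun x => le_of_eq ?_
        rw [ENNReal.mul_rpow_of_nonneg _ _ (by positivity),
          ENNReal.ofReal_rpow_of_pos (by positivity), ← Real.rpow_mul (by positivity)]
        congr 3
        have : (d : ℝ) ≠ 0 := by linarith
        field_simp
        ring
    _ ≤ _ := by
        refine lintegral_mono fun x => ?_
        gcongr
        exact hle x

/-- On the Sobolev line the endpoint `p = d/2`, `q = ∞` fails. The test functions are truncations
`g` of `(1 + |x|²)⁻¹`: both `∫ g^{d/2}` and the value of `(-Δ)⁻¹ g` at the origin are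
controlled by the truncation `A` of the divergent integral of `(1 + |x|²)^{-d/2}`, the latter
growing like `A` but the norm only like `A^{2/d}`. -/
lemma not_bound_laplaceResolvent_zero_top (hd : 3 ≤ d) {p : ℝ≥0∞} (hp : p ≠ 0)
    (hp' : (1 / p).toReal = 2 / (d : ℝ)) {C : ℝ≥0∞} (hC : C ≠ ∞)
    (h : ∀ f : 𝓢(EuclideanSpace ℝ (Fin d), ℂ),
      eLpNorm (laplaceResolvent d 0 f) ∞ volume ≤ C * eLpNorm f p volume) : False := by
  obtain ⟨κ, hκ, hle⟩ := exists_le_enorm_laplaceResolvent_zero hd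
  have hd3 : (3 : ℝ) ≤ d := by exact_mod_cast hd
  have hd0 : (0 : ℝ) < d := by linarith
  have hptop : p ≠ ∞ := by
    rintro rfl
    have : 0 < 2 / (d : ℝ) := by positivity
    rw [← hp'] at this
    simp at this
  let b : ContDiffBump (0 : EuclideanSpace ℝ (Fin d)) := ⟨1, 2, one_pos, one_lt_two⟩
  set A : ℕ → ℝ≥0∞ := fun n => ∫⁻ x : EuclideanSpace ℝ (Fin d),
    ENNReal.ofReal ((1 + ‖x‖ ^ 2) ^ (-((d : ℝ) / 2)) * b (((n : ℝ) + 1)⁻¹ • x)) with hA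
  have hbm : Measurable b := b.continuous.measurable
  have hbcont : Continuous b := b.continuous
  have hbsupp : ∀ n : ℕ, HasCompactSupport fun x => b (((n : ℝ) + 1)⁻¹ • x) := fun n =>
    b.hasCompactSupport.comp_smul (by positivity)
  have hlim : ∀ x : EuclideanSpace ℝ (Fin d), Filter.Tendsto
      (fun n : ℕ => b (((n : ℝ) + 1)⁻¹ • x)) Filter.atTop (nhds 1) := by
    intro x
    have h0 : Filter.Tendsto (fun n : ℕ => ((n : ℝ) + 1)⁻¹ • x) Filter.atTop (nhds 0) := by
      have := (tendsto_one_div_add_atTop_nhds_zero_nat (𝕜 := ℝ)).smul_const x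
      simpa using this
    have hb0 : b 0 = 1 := b.one_of_mem_closedBall (by simp [b])
    have := (hbcont.tendsto 0).comp h0
    rwa [hb0] at this
  -- Fatou: the truncated integrals diverge
  have hAinf : ∞ ≤ Filter.liminf A Filter.atTop := by
    rw [← lintegral_one_add_sq_norm_rpow_eq_top (d := d) (by omega)]
    refine le_trans (lintegral_mono fun x => ?_) (lintegral_liminf_le fun n => by fun_prop)
    refine le_of_eq (Filter.Tendsto.liminf_eq ?_).symm
    have := ENNReal.tendsto_ofReal ((hlim x).const_mul ((1 + ‖x‖ ^ 2) ^ (-((d : ℝ) / 2))))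
    rwa [mul_one] at this
  have hAfin : ∀ n, A n ≠ ∞ := by
    intro n
    refine (Integrable.lintegral_lt_top (Continuous.integrable_of_hasCompactSupport ?_
      (hbsupp n).mul_left)).ne
    refine Continuous.mul (Continuous.rpow_const (by fun_prop) fun x => Or.inl (by positivity)) ?_
    fun_prop
  have hmain : ∀ n, ENNReal.ofReal κ * A n ≤ C * A n ^ (2 / (d : ℝ)) := by
    intro n
    set g : EuclideanSpace ℝ (Fin d) → ℝ :=
      fun x => (1 + ‖x‖ ^ 2)⁻¹ * b (((n : ℝ) + 1)⁻¹ • x) with hg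
    have hg0 : ∀ x, 0 ≤ g x := fun x => mul_nonneg (by positivity) b.nonneg
    obtain ⟨f, hf⟩ := exists_schwartz_of_hasCompactSupport (g := g) (hbsupp n).mul_left (fun k => by
      refine ContDiff.mul (ContDiff.inv (contDiff_const.add (contDiff_norm_sq ℝ))
        fun x => by positivity) ?_
      exact b.contDiff.comp (contDiff_const_smul _))
    have hint : Integrable fun ξ => (laplaceSymbol d 0 ξ)⁻¹ * 𝓕 f ξ := by
      have h1 : Measurable (laplaceSymbol d 0) := (continuous_laplaceSymbol 0).measurable
      have h2 : Measurable fun ξ => 𝓕 f ξ := (𝓕 f).continuous.measurable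
      refine ((integrable_inv_sq_norm_mul hd (𝓕 f)).const_mul ((2 * Real.pi) ^ 2)⁻¹).mono'
        (Measurable.aestronglyMeasurable (by fun_prop)) (Filter.Eventually.of_forall fun ξ => ?_)
      rw [norm_mul, norm_inv, laplaceSymbol, sub_zero, Complex.norm_real, Real.norm_eq_abs,
        abs_of_nonneg (by positivity), mul_pow, mul_inv, mul_assoc]
    have h0 := enorm_le_eLpNorm_top_of_continuous (continuous_laplaceResolvent hint) 0
    have hkey := ((hle f g hg0 hf 0).trans h0).trans (h f)
    have e1 : ∫⁻ y, ENNReal.ofReal ((1 + ‖(0 : EuclideanSpace ℝ (Fin d)) - y‖ ^ 2) ^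
        (1 - (d : ℝ) / 2) * g y) = A n := by
      refine lintegral_congr fun y => ?_
      congr 1
      rw [zero_sub, norm_neg, hg, ← mul_assoc, ← Real.rpow_neg_one,
        ← Real.rpow_add (by positivity)]
      congr 2
      ring
    rw [e1] at hkey
    refine hkey.trans ?_
    gcongr
    rw [eLpNorm_eq_lintegral_rpow_inv hp hptop, hp']
    gcongr
    refine lintegral_mono fun x => ?_
    rw [hf, ← ofReal_norm, Complex.norm_real, Real.norm_eq_abs, abs_of_nonneg (hg0 x),
      ENNReal.ofReal_rpow_of_nonneg (hg0 x) (by positivity)]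
    refine ENNReal.ofReal_le_ofReal ?_
    rw [hg, Real.mul_rpow (by positivity) b.nonneg, ← Real.rpow_neg_one,
      ← Real.rpow_mul (by positivity), one_div_div, neg_one_mul]
    gcongr
    exact Real.rpow_le_self_of_le_one b.nonneg b.le_one (by rw [le_div_iff₀ two_pos]; linarith)
  -- the exponent `2/d` is smaller than one, which bounds `A n`
  set θ : ℝ := 1 - 2 / (d : ℝ) with hθ
  have hθ0 : 0 < θ := by
    have : 2 / (d : ℝ) < 1 := by rw [div_lt_one hd0]; linarith
    linarith
  have hκ0 : ENNReal.ofReal κ ≠ 0 := (ENNReal.ofReal_pos.2 hκ).ne'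
  have hbound : ∀ n, A n ≤ (C / ENNReal.ofReal κ) ^ (1 / θ) := by
    intro n
    rcases eq_or_ne (A n) 0 with h0 | h0
    · rw [h0]; exact zero_le
    rw [← ENNReal.rpow_le_rpow_iff hθ0, ← ENNReal.rpow_mul, one_div_mul_cancel hθ0.ne',
      ENNReal.rpow_one, ENNReal.le_div_iff_mul_le (Or.inl hκ0) (Or.inl ENNReal.ofReal_ne_top),
      hθ, ENNReal.rpow_sub _ _ h0 (hAfin n), ENNReal.rpow_one, mul_comm, ← mul_div_assoc]
    exact ENNReal.div_le_of_le_mul (hmain n)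
  have hfinal : ∞ ≤ (C / ENNReal.ofReal κ) ^ (1 / θ) :=
    hAinf.trans (Filter.liminf_le_of_le (by isBoundedDefault) fun c hc => by
      obtain ⟨n, hn⟩ := hc.exists
      exact hn.trans (hbound n))
  exact ENNReal.rpow_ne_top_of_nonneg (by positivity) (ENNReal.div_ne_top hC hκ0)
    (top_le_iff.1 hfinal)

/-- In dimension two the bound `L¹ → L^∞` fails, since `∫ |ξ|⁻²` diverges logarithmically. The
test function has a bump as Fourier transform, and its rescaled resolvents are evaluated at the
origin; multiplying by `conj w`, with `w` as in `exists_rotation`, makes the real part of the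
symbol's inverse nonnegative. -/
lemma not_bound_laplaceResolvent_two {z : ℂ}
    (hz : z ∉ (fun t : ℝ => (t : ℂ)) '' Set.Ici 0) {p C : ℝ≥0∞}
    (hp : (1 / p).toReal = 1) (hC : C ≠ ∞) (h : ∀ f : 𝓢(EuclideanSpace ℝ (Fin 2), ℂ),
      eLpNorm (laplaceResolvent 2 z f) ∞ volume ≤ C * eLpNorm f p volume) : False := by
  obtain ⟨ψ, g, hg0, hg1, hψ⟩ := exists_schwartz_bump 2
  obtain ⟨w, hw, hwz⟩ := exists_rotation hz
  obtain ⟨κ, hκ, hle⟩ := exists_le_norm_sub hz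
  set f : 𝓢(EuclideanSpace ℝ (Fin 2), ℂ) := 𝓕⁻ ψ with hf
  have hFf : 𝓕 f = ψ := FourierTransform.fourier_fourierInv_eq ψ
  set K : ℝ≥0∞ := C * eLpNorm f p volume with hK
  have hKtop : K ≠ ∞ := ENNReal.mul_ne_top hC (f.memLp p volume).2.ne
  set ε : ℕ → ℝ := fun n => (((n : ℝ) + 1) ^ 2)⁻¹ with hε
  have hεpos : ∀ n, 0 < ε n := fun n => by positivity
  set m : ℕ → EuclideanSpace ℝ (Fin 2) → ℂ := fun n => laplaceSymbol 2 ((ε n : ℂ) * z) with hm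
  have hmc : ∀ n, Continuous (m n) := fun n => continuous_laplaceSymbol _
  have hmle : ∀ n ξ, κ * ε n ≤ ‖m n ξ‖ := by
    intro n ξ
    have := hle ((2 * Real.pi * ‖ξ‖) ^ 2) (ε n) (by positivity) (hεpos n).le
    refine le_trans ?_ this
    gcongr
    exact le_add_of_nonneg_left (by positivity)
  have hm0 : ∀ n ξ, m n ξ ≠ 0 := fun n ξ =>
    norm_pos_iff.1 ((mul_pos hκ (hεpos n)).trans_le (hmle n ξ))
  have hint : ∀ n, Integrable fun ξ => (m n ξ)⁻¹ * 𝓕 f ξ := by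
    intro n
    refine (𝓕 f).integrable.bdd_mul (c := (κ * ε n)⁻¹)
      ((hmc n).inv₀ (hm0 n)).aestronglyMeasurable (Filter.Eventually.of_forall fun ξ => ?_)
    rw [norm_inv]
    exact inv_anti₀ (mul_pos hκ (hεpos n)) (hmle n ξ)
  -- for `d = 2`, `p = 1`, `q = ∞` the power of the dilation parameter in the bound is zero
  have hval : ∀ n, ‖laplaceResolvent 2 ((ε n : ℂ) * z) f 0‖ₑ ≤ K := by
    intro n
    refine (enorm_le_eLpNorm_top_of_continuous (continuous_laplaceResolvent (hint n)) 0).trans ?_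
    have := eLpNorm_laplaceResolvent_rescaled' h f (r := (n : ℝ) + 1) (by positivity)
    rwa [hp, ENNReal.div_top, ENNReal.toReal_zero, show (2 : ℝ) - ((2 : ℕ) : ℝ) * (1 - 0) = 0 by
      norm_num, Real.rpow_zero, ENNReal.ofReal_one, one_mul] at this
  set H : ℕ → EuclideanSpace ℝ (Fin 2) → ℝ := fun n ξ =>
    (w * m n ξ).re / ‖m n ξ‖ ^ 2 * g ξ with hH
  have hHeq : ∀ n ξ, H n ξ = ((starRingEnd ℂ) w * ((m n ξ)⁻¹ * 𝓕 f ξ)).re := by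
    intro n ξ
    rw [hFf, hψ, ← mul_assoc, Complex.re_mul_ofReal, Complex.inv_def, ← mul_assoc, ← map_mul,
      Complex.re_mul_ofReal, Complex.conj_re, Complex.normSq_eq_norm_sq, hH]
    rfl
  have hHre : ∀ n ξ, 0 ≤ (w * m n ξ).re := by
    intro n ξ
    rw [hm, re_mul_laplaceSymbol, mul_left_comm, ← mul_neg, Complex.re_ofReal_mul]
    have := hεpos n
    positivity
  have hH0 : ∀ n ξ, 0 ≤ H n ξ := fun n ξ =>
    mul_nonneg (div_nonneg (hHre n ξ) (by positivity)) (hg0 ξ)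
  have hHle : ∀ n, ∫⁻ ξ, ENNReal.ofReal (H n ξ) ≤ ‖w‖ₑ * K := by
    intro n
    have hHi : Integrable (H n) := by
      have := ((hint n).const_mul ((starRingEnd ℂ) w)).re
      exact this.congr (Filter.Eventually.of_forall fun ξ => (hHeq n ξ).symm)
    rw [← ofReal_integral_eq_lintegral_ofReal hHi (Filter.Eventually.of_forall (hH0 n))]
    have e : ∫ ξ, H n ξ =
        ((starRingEnd ℂ) w * laplaceResolvent 2 ((ε n : ℂ) * z) f 0).re := by
      have e1 : laplaceResolvent 2 ((ε n : ℂ) * z) f 0 = ∫ ξ, (m n ξ)⁻¹ * 𝓕 f ξ := by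
        rw [laplaceResolvent_apply]
        simp [hm]
      rw [e1, ← integral_const_mul]
      simp_rw [hHeq]
      exact integral_re ((hint n).const_mul _)
    rw [e]
    refine (ENNReal.ofReal_le_ofReal (Complex.re_le_norm _)).trans ?_
    rw [ofReal_norm, enorm_mul, RCLike.enorm_conj]
    gcongr
    exact hval n
  have hgm : Measurable g := by
    have : g = fun y => (ψ y).re := by ext y; simp [hψ]
    rw [this]; exact (Complex.continuous_re.comp ψ.continuous).measurable
  have hfat : ∫⁻ ξ : EuclideanSpace ℝ (Fin 2),
      ENNReal.ofReal (w.re * ((2 * Real.pi * ‖ξ‖) ^ 2)⁻¹ * g ξ) ≤ ‖w‖ₑ * K := by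
    calc _ ≤ ∫⁻ ξ, Filter.liminf (fun n => ENNReal.ofReal (H n ξ)) Filter.atTop := by
          refine lintegral_mono_ae ?_
          filter_upwards [Measure.ae_ne volume (0 : EuclideanSpace ℝ (Fin 2))] with ξ hξ
          have hξ' := norm_pos_iff.2 hξ
          refine le_of_eq (Filter.Tendsto.liminf_eq (ENNReal.tendsto_ofReal ?_)).symm
          have hε0 : Filter.Tendsto ε Filter.atTop (nhds 0) := by
            have := (tendsto_one_div_add_atTop_nhds_zero_nat (𝕜 := ℝ)).pow 2
            simpa [hε] using this
          have hc : Filter.Tendsto (fun n => m n ξ) Filter.atTop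
              (nhds (((2 * Real.pi * ‖ξ‖) ^ 2 : ℝ) : ℂ)) := by
            have := ((Complex.continuous_ofReal.tendsto _).comp hε0).mul_const z
            have h2 := this.const_sub (((2 * Real.pi * ‖ξ‖) ^ 2 : ℝ) : ℂ)
            simpa [hm, laplaceSymbol] using h2
          have hs : (0 : ℝ) < (2 * Real.pi * ‖ξ‖) ^ 2 := by positivity
          have h3 := (((Complex.continuous_re.tendsto _).comp (hc.const_mul w)).div
            (hc.norm.pow 2) (by
              rw [Complex.norm_real, Real.norm_eq_abs, abs_of_pos hs]
              positivity)).mul_const (g ξ)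
          refine (h3.congr fun n => rfl).trans (le_of_eq ?_)
          congr 1
          rw [Complex.re_mul_ofReal, Complex.norm_real, Real.norm_eq_abs, abs_of_pos hs]
          field_simp
      _ ≤ Filter.liminf (fun n => ∫⁻ ξ, ENNReal.ofReal (H n ξ)) Filter.atTop := by
          refine lintegral_liminf_le fun n => ?_
          have := (hmc n).measurable
          simp only [hH]
          refine ENNReal.measurable_ofReal.comp ?_
          refine Measurable.mul (Measurable.div ?_ (by fun_prop)) hgm
          exact Complex.measurable_re.comp (by fun_prop)
      _ ≤ _ := Filter.liminf_le_of_le (by isBoundedDefault) fun c hc => by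
          obtain ⟨n, hn⟩ := hc.exists
          exact hn.trans (hHle n)
  have hI : Integrable fun ξ : EuclideanSpace ℝ (Fin 2) =>
      w.re * ((2 * Real.pi * ‖ξ‖) ^ 2)⁻¹ * g ξ :=
    (lintegral_ofReal_ne_top_iff_integrable (Measurable.aestronglyMeasurable (by fun_prop))
      (Filter.Eventually.of_forall fun ξ => by have := hg0 ξ; positivity)).1
      (ne_top_of_le_ne_top (ENNReal.mul_ne_top (by simp) hKtop) hfat)
  have hball : IntegrableOn (fun ξ : EuclideanSpace ℝ (Fin 2) => (‖ξ‖ ^ 2)⁻¹)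
      (Metric.ball 0 1) := by
    refine ((hI.const_mul ((2 * Real.pi) ^ 2 / w.re)).integrableOn).congr_fun (fun ξ hξ => ?_)
      measurableSet_ball
    have hξ1 : ‖ξ‖ ≤ 1 := (by simpa using hξ : ‖ξ‖ < 1).le
    simp only [hg1 ξ hξ1, mul_pow, mul_inv]
    field_simp
  rw [integrableOn_fun_norm_addHaar volume (f := fun r : ℝ => (r ^ 2)⁻¹)] at hball
  have hlog : IntegrableOn (fun y : ℝ => y ^ (-1 : ℝ)) (Set.Ioo 0 1) := by
    refine hball.congr_fun (fun y hy => ?_) measurableSet_Ioo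
    have hy0 : y ≠ 0 := hy.1.ne'
    simp only [finrank_euclideanSpace, Fintype.card_fin, smul_eq_mul, Real.rpow_neg_one,
      Nat.add_one_sub_one, pow_one]
    field_simp
  exact absurd ((intervalIntegral.integrableOn_Ioo_rpow_iff one_pos).1 hlog) (lt_irrefl _)

lemma toReal_one_div_le_one {p : ℝ≥0∞} (hp : 1 ≤ p) : (1 / p).toReal ≤ 1 := by
  have h : 1 / p ≤ 1 := by
    rw [one_div]; exact ENNReal.inv_le_one.2 hp
  simpa using ENNReal.toReal_mono ENNReal.one_ne_top h

end

theorem proposition1p1 (d : ℕ) (hd : 2 ≤ d) (p q : ℝ≥0∞) (hp : 1 ≤ p) (hq : 1 ≤ q)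
    (z : ℂ) (hz : z ∉ (fun t : ℝ => (t : ℂ)) '' Set.Ici 0) :
    resolventNorm d z p q < ∞ ↔ ((1 / p).toReal, (1 / q).toReal) ∈ regionR0 d := by
  have hp0 : p ≠ 0 := (one_pos.trans_le hp).ne'
  have hq0 : q ≠ 0 := (one_pos.trans_le hq).ne'
  have hx1 := toReal_one_div_le_one hp
  have hy1 := toReal_one_div_le_one hq
  have hx0 : 0 ≤ (1 / p).toReal := ENNReal.toReal_nonneg
  have hy0 : 0 ≤ (1 / q).toReal := ENNReal.toReal_nonneg
  have hd0 : (0 : ℝ) < d := by exact_mod_cast (by omega : 0 < d)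
  have htop : ∀ r : ℝ≥0∞, r ≠ 0 → (1 / r).toReal = 0 → r = ∞ := fun r hr h => by
    by_contra hr'
    exact (toReal_one_div_pos hr hr').ne' h
  rw [resolventNorm_lt_top_iff]
  constructor
  · rintro ⟨C, hC, hbound⟩
    have hyx := toReal_one_div_le_of_bound (by omega) hz hq0 hC hbound
    by_cases hd2 : d = 2
    · subst hd2
      simp only [regionR0, if_true]
      refine ⟨hx0, hx1, hy0, hy1, sub_nonneg.2 hyx, ?_⟩
      by_contra! hge
      simp only at hge
      have hx : (1 / p).toReal = 1 := by linarith
      have hy : (1 / q).toReal = 0 := by linarith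
      obtain rfl := htop q hq0 hy
      exact not_bound_laplaceResolvent_two hz hx hC hbound
    · have hd3 : 3 ≤ d := by omega
      simp only [regionR0, if_neg hd2]
      have hle : (1 / p).toReal - (1 / q).toReal ≤ 2 / d := by
        by_contra! hgt
        rw [div_lt_iff₀ hd0] at hgt
        have hL : Filter.Tendsto (fun n : ℕ => ((n : ℝ) + 1) ^
            (2 - (d : ℝ) * ((1 / p).toReal - (1 / q).toReal))) Filter.atTop (nhds 0) := by
          have := tendsto_natCast_add_one_rpow_neg
            (e := (d : ℝ) * ((1 / p).toReal - (1 / q).toReal) - 2) (by linarith)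
          simpa using this
        obtain ⟨f, c, hc, hlow⟩ := exists_le_enorm_laplaceResolvent_zero_bump hd3
        have h0 := eLpNorm_laplaceResolvent_zero_le hd3 hz hC hbound hL f
        rw [ENNReal.ofReal_zero, zero_mul, nonpos_iff_eq_zero,
          eLpNorm_eq_zero_iff (aestronglyMeasurable_laplaceResolvent 0 f) hq0] at h0
        obtain ⟨x, hx⟩ := h0.exists
        have hlx := hlow x
        rw [hx, Pi.zero_apply, enorm_zero, nonpos_iff_eq_zero, mul_eq_zero,
          ENNReal.ofReal_eq_zero] at hlx
        have : (0 : ℝ) < (1 + ‖x‖ ^ 2) ^ (1 - (d : ℝ) / 2) := by positivity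
        rcases hlx with h | h
        · exact hc h
        · linarith
      have hline : (1 / p).toReal - (1 / q).toReal = 2 / d →
          ∀ f, eLpNorm (laplaceResolvent d 0 f) q volume ≤ C * eLpNorm f p volume := by
        intro he f
        have hL : Filter.Tendsto (fun n : ℕ => ((n : ℝ) + 1) ^
            (2 - (d : ℝ) * ((1 / p).toReal - (1 / q).toReal))) Filter.atTop (nhds 1) := by
          rw [he, mul_div_cancel₀ _ hd0.ne', sub_self]
          simp
        simpa using eLpNorm_laplaceResolvent_zero_le hd3 hz hC hbound hL f
      refine ⟨⟨hx0, hx1, hy0, hy1, sub_nonneg.2 hyx, hle⟩, ?_⟩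
      simp only [Set.mem_insert_iff, Set.mem_singleton_iff, Prod.mk.injEq, not_or, not_and]
      refine ⟨fun hx hy => ?_, fun hx hy => ?_⟩
      · obtain ⟨f, hf⟩ := eLpNorm_laplaceResolvent_zero_bump_eq_top hd3 hq0 hy
        have h := hline (by rw [hx, hy]; field_simp; ring) f
        rw [hf, top_le_iff] at h
        exact ENNReal.mul_ne_top hC (f.memLp p volume).2.ne h
      · obtain rfl := htop q hq0 hy
        exact not_bound_laplaceResolvent_zero_top hd3 hp0 hx hC (hline (by rw [hx, hy, sub_zero]))
  · intro hmem
    by_cases hd2 : d = 2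
    · subst hd2
      simp only [regionR0, if_true] at hmem
      obtain ⟨-, -, -, -, h0, h1⟩ := hmem
      exact exists_eLpNorm_laplaceResolvent_le_of_lt hz hd hp hq (sub_nonneg.1 h0)
        (by simpa using h1)
    · simp only [regionR0, if_neg hd2] at hmem
      obtain ⟨⟨-, -, -, -, h0, h1⟩, hne⟩ := hmem
      rcases lt_or_eq_of_le h1 with h1 | h1
      · exact exists_eLpNorm_laplaceResolvent_le_of_lt hz hd hp hq (sub_nonneg.1 h0) h1
      · simp only [Set.mem_insert_iff, Set.mem_singleton_iff, Prod.mk.injEq, not_or,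
          not_and] at hne h1
        have hp1 : p ≠ 1 := by
          rintro rfl
          simp only [div_one, ENNReal.toReal_one] at hne h1
          refine hne.1 trivial ?_
          field_simp at h1 ⊢
          linarith
        have hqtop : q ≠ ∞ := by
          rintro rfl
          simp only [ENNReal.div_top, ENNReal.toReal_zero, sub_zero] at hne h1
          exact hne.2 h1 trivial
        have hptop : p ≠ ∞ := by
          rintro rfl
          rw [ENNReal.div_top, ENNReal.toReal_zero] at h1
          have : 0 < 2 / (d : ℝ) := by positivity
          linarith
        exact exists_eLpNorm_laplaceResolvent_le_of_eq hz hd (lt_of_le_of_ne hp hp1.symm) hptop hq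
          hqtop h1
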